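/- For every constant $c>0$ there is a constant $C>0$, depending only on $c$, such that the following holds. Let $G=(V,E)$ be a finite undirected, unweighted multigraph with $n=|V|$ (parallel edges are allowed; if loops are present, a loop at $x$ counts twice in $\deg(x)$ and in the adjacency matrix entry $A_{xx}$). Let $T\subseteq V$ be arbitrary, $F=V\setminus T$, let $\varepsilon\in(0,1)$, and let $\rho$ be any natural number with $\rho\ge C\,\varepsilon^{-2}\log n$; in particular $\rho=\lceil C\varepsilon^{-2}\log n\rceil=O(\varepsilon^{-2}\log n)$ is allowed. Let $L=D-A$ be the Laplacian of $G$, and let $$\mathrm{SC}(G,T)=L_{[T,T]}-L_{[T,F]}\,L_{[F,F]}^{\dagger}\,L_{[F,T]}$$ be its Schur complement onto $T$, where $\dagger$ is the Moore--Penrose pseudo-inverse. A step of the random walk on $G$ from $x$ goes to $y$ with probability $A_{xy}/\deg(x)$. Construct a random weighted graph $H$ on the vertex set $T$, starting with no edges, as follows. For every edge $e=(u,v)$ of $G$, repeat $\rho$ times, all walks being mutually independent: 1. run a random walk from $u$ until it hits $T$, at a vertex $t_1$; 2. run a random walk from $v$ until it hits $T$, at a vertex $t_2$; 3. let $\ell$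 be the total number of edges of the combined walk, the edge $e$ included, and add to $H$ an edge between $t_1$ and $t_2$ of weight $\frac{1}{\rho\ell}$. A walk that starts in $T$ hits $T$ at once, after $0$ steps. If one of the two walks never hits $T$, then nothing is added in that repetition. Then, with probability at least $1-n^{-c}$, $L_H\approx_\varepsilon \mathrm{SC}(G,T)$, that is, for all $x\in\mathbb{R}^T$ $$(1-\varepsilon)\,x^{\top}\mathrm{SC}(G,T)\,x\;\le\; x^{\top}L_H\,x\;\le\;(1+\varepsilon)\,x^{\top}\mathrm{SC}(G,T)\,x,$$ and any two distinct vertices of $T$ that are adjacent in $H$ are also adjacent in the weighted graph whose Laplacian is $\mathrm{SC}(G,T)$, i.e. the corresponding entry of $\mathrm{SC}(G,T)$ is nonzero. -/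

import Mathlib

open MeasureTheory ProbabilityTheory
open scoped Graph

namespace SchurWalks

/-! ### Laplacians of multigraphs and of weighted graphs -/

section Laplacian

variable {α β : Type*}

open Classical in
/-- The number of edges of the multigraph `G` between `x` and `y`, i.e. the `(x, y)` entry of the
adjacency matrix. As usual for undirected multigraphs, a loop at `x` counts twice in the entry
`(x, x)`, so that row sums are degrees with a loop contributing two. -/
noncomputable def edgeMult (G : Graph α β) [Fintype E(G)] (x y : V(G)) : ℕ :=
  (if x = y then 2 else 1) * Fintype.card {e : E(G) // G.IsLink e x y}

/-- The adjacency matrix of the multigraph `G`. -/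
noncomputable def adjMatrix (G : Graph α β) [Fintype E(G)] : Matrix V(G) V(G) ℝ :=
  fun x y => (edgeMult G x y : ℝ)

open Classical in
/-- The Laplacian `D - A` of a weighted graph with (symmetric) adjacency matrix `A`, where `D` is
the diagonal matrix of weighted degrees. -/
noncomputable def lap {n : Type*} [Fintype n] (A : Matrix n n ℝ) : Matrix n n ℝ :=
  Matrix.diagonal (fun x => ∑ y, A x y) - A

end Laplacian

/-! ### The Moore-Penrose pseudo-inverse -/

section PseudoInverse

open Matrix

variable {m n : Type*} [Fintype m] [Fintype n]

/-- The four Penrose equations for real matrices. -/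
structure IsMoorePenrose (A : Matrix m n ℝ) (X : Matrix n m ℝ) : Prop where
  mul_mul : A * X * A = A
  inv_mul_mul : X * A * X = X
  symm_left : (A * X)ᵀ = A * X
  symm_right : (X * A)ᵀ = X * A

theorem IsMoorePenrose.unique {A : Matrix m n ℝ} {X Y : Matrix n m ℝ}
    (hX : IsMoorePenrose A X) (hY : IsMoorePenrose A Y) : X = Y := by
  have h1 : A * X = A * Y := by
    calc A * X = (A * X)ᵀ := hX.symm_left.symm
      _ = ((A * Y) * (A * X))ᵀ := by rw [← Matrix.mul_assoc, hY.mul_mul]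
      _ = (A * X) * (A * Y) := by rw [Matrix.transpose_mul, hX.symm_left, hY.symm_left]
      _ = A * Y := by rw [← Matrix.mul_assoc, hX.mul_mul]
  have h2 : X * A = Y * A := by
    calc X * A = (X * A)ᵀ := hX.symm_right.symm
      _ = ((X * A) * (Y * A))ᵀ := by
          rw [Matrix.mul_assoc, ← Matrix.mul_assoc A, hY.mul_mul]
      _ = (Y * A) * (X * A) := by rw [Matrix.transpose_mul, hX.symm_right, hY.symm_right]
      _ = Y * A := by rw [Matrix.mul_assoc, ← Matrix.mul_assoc A, hX.mul_mul]
  calc X = X * A * X := hX.inv_mul_mul.symm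
    _ = Y * (A * X) := by rw [h2, Matrix.mul_assoc]
    _ = Y := by rw [h1, ← Matrix.mul_assoc, hY.inv_mul_mul]

theorem exists_isMoorePenrose_of_symm [DecidableEq n] (B : Matrix n n ℝ) (hB : B.IsHermitian) :
    ∃ P : Matrix n n ℝ, IsMoorePenrose B P ∧ Pᵀ = P := by
  set U : Matrix n n ℝ := (hB.eigenvectorUnitary : Matrix n n ℝ) with hU
  set d : n → ℝ := hB.eigenvalues with hd
  have hUU : Uᵀ * U = 1 := by
    have := Unitary.coe_star_mul_self hB.eigenvectorUnitary
    simpa [Matrix.star_eq_conjTranspose, Matrix.conjTranspose_eq_transpose_of_trivial] using this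
  have hBd : B = U * diagonal d * Uᵀ := by
    have := hB.spectral_theorem
    simpa [Unitary.conjStarAlgAut_apply, Matrix.star_eq_conjTranspose,
      Matrix.conjTranspose_eq_transpose_of_trivial, Function.comp_def] using this
  have key : ∀ a b : n → ℝ, (U * diagonal a * Uᵀ) * (U * diagonal b * Uᵀ) =
      U * diagonal (fun i => a i * b i) * Uᵀ := by
    intro a b
    calc _ = U * diagonal a * (Uᵀ * U) * diagonal b * Uᵀ := by simp only [Matrix.mul_assoc]
      _ = _ := by rw [hUU, Matrix.mul_one, Matrix.mul_assoc U, Matrix.diagonal_mul_diagonal]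
  have tr : ∀ a : n → ℝ, (U * diagonal a * Uᵀ)ᵀ = U * diagonal a * Uᵀ := by
    intro a
    simp [Matrix.transpose_mul, Matrix.mul_assoc]
  refine ⟨U * diagonal (fun i => (d i)⁻¹) * Uᵀ, ⟨?_, ?_, ?_, ?_⟩, tr _⟩
  · rw [hBd, key, key]; congr 3; funext i; exact mul_inv_mul_cancel (d i)
  · rw [hBd, key, key]; congr 3; funext i; simpa using mul_inv_mul_cancel (d i)⁻¹
  · rw [hBd, key, tr]
  · rw [hBd, key, tr]

theorem exists_isMoorePenrose (A : Matrix m n ℝ) : ∃ X : Matrix n m ℝ, IsMoorePenrose A X := by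
  classical
  have hB : (Aᵀ * A).IsHermitian := by
    simp [Matrix.IsHermitian, Matrix.conjTranspose_eq_transpose_of_trivial, Matrix.transpose_mul]
  obtain ⟨P, hP, hPt⟩ := exists_isMoorePenrose_of_symm (Aᵀ * A) hB
  refine ⟨P * Aᵀ, ⟨?_, ?_, ?_, ?_⟩⟩
  · have h0 : A * (P * (Aᵀ * A) - 1) = 0 := by
      rw [← Matrix.conjTranspose_mul_self_eq_zero, Matrix.conjTranspose_eq_transpose_of_trivial]
      have : (Aᵀ * A) * (P * (Aᵀ * A) - 1) = 0 := by
        rw [Matrix.mul_sub, ← Matrix.mul_assoc, hP.mul_mul, Matrix.mul_one, sub_self]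
      rw [Matrix.transpose_mul, Matrix.mul_assoc, ← Matrix.mul_assoc Aᵀ, this, Matrix.mul_zero]
    rw [Matrix.mul_sub, Matrix.mul_one, sub_eq_zero] at h0
    simpa [Matrix.mul_assoc] using h0
  · have := congrArg (· * Aᵀ) hP.inv_mul_mul
    simpa [Matrix.mul_assoc] using this
  · simp [Matrix.transpose_mul, hPt, Matrix.mul_assoc]
  · simpa [Matrix.mul_assoc] using hP.symm_right

/-- The Moore-Penrose pseudo-inverse of a real matrix: the unique solution of the four Penrose
equations. -/
noncomputable def pinv (A : Matrix m n ℝ) : Matrix n m ℝ := (exists_isMoorePenrose A).choose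

theorem pinv_spec (A : Matrix m n ℝ) : IsMoorePenrose A (pinv A) :=
  (exists_isMoorePenrose A).choose_spec

end PseudoInverse

/-! ### Schur complement and spectral approximation -/

open Classical in
/-- The Schur complement `L[T,T] - L[T,F] L[F,F]⁺ L[F,T]` of `L` onto `T`, with `F` the complement
of `T`. -/
noncomputable def schurOnto {n : Type*} [Fintype n] (L : Matrix n n ℝ) (T : Set n) :
    Matrix T T ℝ :=
  L.submatrix (fun x : T => (x : n)) (fun y : T => (y : n)) -
    L.submatrix (fun x : T => (x : n)) (fun y : (Tᶜ : Set n) => (y : n)) *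
      pinv (L.submatrix (fun x : (Tᶜ : Set n) => (x : n)) (fun y : (Tᶜ : Set n) => (y : n))) *
      L.submatrix (fun x : (Tᶜ : Set n) => (x : n)) (fun y : T => (y : n))

/-- `SC(G, T)`, the Schur complement onto `T` of the Laplacian of the multigraph `G`. -/
noncomputable def SC {α β : Type*} (G : Graph α β) [Fintype V(G)] [Fintype E(G)]
    (T : Set V(G)) : Matrix T T ℝ :=
  schurOnto (lap (adjMatrix G)) T

/-- `M ≈_ε N` for Laplacian matrices `M`, `N` of weighted graphs on the same vertices: every edge
(nonzero off-diagonal entry) of the first graph joins two vertices that are joined by an edge of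
the second one, and the quadratic forms agree up to factors `1 ± ε`. -/
structure SpectralApprox {n : Type*} [Fintype n] (ε : ℝ) (M N : Matrix n n ℝ) : Prop where
  edges_subset : ∀ s t : n, s ≠ t → M s t ≠ 0 → N s t ≠ 0
  lower : ∀ x : n → ℝ, (1 - ε) * (x ⬝ᵥ N.mulVec x) ≤ x ⬝ᵥ M.mulVec x
  upper : ∀ x : n → ℝ, x ⬝ᵥ M.mulVec x ≤ (1 + ε) * (x ⬝ᵥ N.mulVec x)

/-! ### Random walks -/

section Walks

variable {α β : Type*}

instance vertexMeasurableSpace (G : Graph α β) : MeasurableSpace V(G) := ⊤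

instance vertexDiscrete (G : Graph α β) : DiscreteMeasurableSpace V(G) := ⟨fun _ => trivial⟩

open Classical in
/-- One step of the simple random walk on `G` from `x`: the next vertex is `y` with probability
proportional to the number of edges between `x` and `y`. (At an isolated vertex the walk stays.) -/
noncomputable def stepLaw (G : Graph α β) [Fintype V(G)] [Fintype E(G)] (x : V(G)) : PMF V(G) :=
  if h : ∃ y, edgeMult G x y ≠ 0 then
    PMF.normalize (fun y => (edgeMult G x y : ENNReal))
      (by
        obtain ⟨y, hy⟩ := h
        exact fun h0 => hy (by exact_mod_cast ENNReal.tsum_eq_zero.mp h0 y))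
      (by
        rw [tsum_fintype]
        exact ENNReal.sum_ne_top.mpr fun _ _ => ENNReal.natCast_ne_top _)
  else PMF.pure x

/-- The transition kernel of the random walk, from the history up to time `k` to the position at
time `k + 1`; it depends only on the position at time `k`. -/
noncomputable def stepKernel (G : Graph α β) [Fintype V(G)] [Fintype E(G)] (k : ℕ) :
    Kernel (∀ _ : Finset.Iic k, V(G)) V(G) :=
  Kernel.comap (⟨fun x => (stepLaw G x).toMeasure, Measurable.of_discrete⟩ : Kernel V(G) V(G))
    (fun h => h ⟨k, Finset.mem_Iic.mpr le_rfl⟩) (measurable_pi_apply _)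

instance stepKernel_markov (G : Graph α β) [Fintype V(G)] [Fintype E(G)] (k : ℕ) :
    IsMarkovKernel (stepKernel G k) :=
  ⟨fun h => PMF.toMeasure.isProbabilityMeasure
    (stepLaw G (h ⟨k, Finset.mem_Iic.mpr le_rfl⟩))⟩

/-- The law, on infinite trajectories, of the random walk on `G` started at `u`. -/
noncomputable def walkLaw (G : Graph α β) [Fintype V(G)] [Fintype E(G)] (u : V(G)) :
    Measure (ℕ → V(G)) :=
  Kernel.traj (X := fun _ => V(G)) (stepKernel G) 0 (fun _ => u)

instance walkLaw_prob (G : Graph α β) [Fintype V(G)] [Fintype E(G)] (u : V(G)) :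
    IsProbabilityMeasure (walkLaw G u) := by
  unfold walkLaw; infer_instance

/-! ### The random graph `H` -/

/-- The trajectory `X` hits the set `T`. -/
def Hits {S : Type*} (T : Set S) (X : ℕ → S) : Prop := ∃ k, X k ∈ T

open Classical in
/-- The first time at which `X` is in `T`. -/
noncomputable def hitTime {S : Type*} {T : Set S} {X : ℕ → S} (h : Hits T X) : ℕ := Nat.find h

open Classical in
/-- The vertex at which `X` first hits `T`. -/
noncomputable def hitPoint {S : Type*} {T : Set S} {X : ℕ → S} (h : Hits T X) : T :=
  ⟨X (hitTime h), Nat.find_spec h⟩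

open Classical in
/-- Adjacency matrix of the edge that one repetition of the procedure adds to `H`: if `X` and `Y`
(the walks from the two endpoints) hit `T` at `t₁` and `t₂`, an edge between `t₁` and `t₂` of
weight `1 / (ρ ℓ)`, with `ℓ` the number of edges of the combined walk, the starting edge included.
If one of the walks never hits `T`, nothing is added. -/
noncomputable def sampleAdj {S : Type*} (T : Set S) (ρ : ℕ) (X Y : ℕ → S) : Matrix T T ℝ :=
  if h : Hits T X ∧ Hits T Y then
    (1 / ((ρ : ℝ) * ((hitTime h.1 + 1 + hitTime h.2 : ℕ) : ℝ))) •
      (Matrix.single (hitPoint h.1) (hitPoint h.2) 1 +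
        Matrix.single (hitPoint h.2) (hitPoint h.1) 1)
  else 0

open Classical in
/-- The Laplacian of `H`, given for each edge `e` and each repetition `i` the two trajectories
started at the endpoints of `e`. -/
noncomputable def sampledLaplacian (G : Graph α β) [Fintype V(G)] [Fintype E(G)] (T : Set V(G))
    (ρ : ℕ) (ω : E(G) × Fin ρ → (ℕ → V(G)) × (ℕ → V(G))) : Matrix T T ℝ :=
  lap (∑ p, sampleAdj T ρ (ω p).1 (ω p).2)

/-- The joint law of all the trajectories: for each edge `e = (u, v)` (with endpoints listed by
`ends`) and each of the `ρ` repetitions, a random walk from `u` and one from `v`, all of them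
mutually independent. -/
noncomputable def samplingLaw (G : Graph α β) [Fintype V(G)] [Fintype E(G)]
    (ends : E(G) → V(G) × V(G)) (ρ : ℕ) :
    Measure (E(G) × Fin ρ → (ℕ → V(G)) × (ℕ → V(G))) :=
  Measure.pi fun p => (walkLaw G (ends p.1).1).prod (walkLaw G (ends p.1).2)

end Walks

end SchurWalks

/-!
The sampled Laplacian is a sum of independent positive semidefinite matrices, one for each edge and
each repetition. Three facts give the theorem.

*Unbiasedness.* Let `Q` be the transition matrix of the walk killed on `T`, and `A` the adjacency
matrix. The probability of first hitting `T` at `s` after `i` steps from `u` is `(Q ^ i) u s`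
(`walkLaw_firstHit`). Reversibility `Qᵀ * A = A * Q` turns the expected weight between `s` and `t`
into a sum over `i, j` of `(A * Q ^ (i + j)) s t / (i + j + 1)`; since there are `ℓ` pairs with
`i + j + 1 = ℓ`, the factor `1 / ℓ` cancels and `∑ l, (A * Q ^ l) s t` remains
(`sum_adjMatrix_mul_integral_orientedWeight`). This is the weight of all excursions from `s` to `t`
off `T`, which is `-SC G T s t` for `s ≠ t` because the hitting probabilities are the harmonic
extension of the unit vectors on `T` (`schurOnto_eq_of_harmonic`, `SC_eq_lap_excursionMatrix`).

*Domination.* A sampled edge comes from a walk of `ℓ` edges between its ends, so by Cauchy-Schwarz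
along a path, `(x s - x t) ^ 2 / ℓ` is at most the energy of the harmonic extension of `x`, which is
the quadratic form of the Schur complement (`sq_sub_le_of_killedMatrix_pow_ne_zero`). Hence each
sample is at most `ρ⁻¹ • SC G T`.

*Concentration.* Whiten by the square root of the Schur complement, and let `Z` be the deviation of
the sum from its mean. Exchanging one sample with an independent copy and a mean-value inequality
for traces (`trace_sub_mul_pow_sub_pow_le`) bound the expectation of `trace (Z ^ (2k + 2))` by
`10 (k + 1) / ρ` times that of `trace (Z ^ (2k))`
(`integral_trace_centeredSum_pow_succ_le`). Iterating `K ≈ (c + 1) log n` times and applying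
Markov's inequality gives the failure probability `n (10 K / (ρ ε²)) ^ K ≤ n ^ (-c)`. No matrix
exponentials are needed, and the summands need not be identically distributed.

The adjacency condition holds almost surely, since a nonnegative weight with expectation zero
vanishes (`ae_outcomeAdj_eq_zero`).
-/

namespace SchurWalks

/-! ### Trace inequalities for symmetric matrices -/

section TraceInequalities

open Matrix

variable {n : Type*} [Fintype n] [DecidableEq n]

theorem exists_pow_eq_orthogonal_conj {A : Matrix n n ℝ} (hA : A.IsHermitian) :
    ∃ (U : Matrix n n ℝ) (a : n → ℝ), Uᵀ * U = 1 ∧ U * Uᵀ = 1 ∧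
      ∀ p : ℕ, A ^ p = U * diagonal (fun i => a i ^ p) * Uᵀ := by
  set U : Matrix n n ℝ := (hA.eigenvectorUnitary : Matrix n n ℝ) with hU
  have hUU : Uᵀ * U = 1 := by
    have := Unitary.coe_star_mul_self hA.eigenvectorUnitary
    simpa [Matrix.star_eq_conjTranspose, Matrix.conjTranspose_eq_transpose_of_trivial] using this
  have hUU' : U * Uᵀ = 1 := mul_eq_one_comm.mp hUU
  have hAd : A = U * diagonal hA.eigenvalues * Uᵀ := by
    have := hA.spectral_theorem
    simpa [Unitary.conjStarAlgAut_apply, Matrix.star_eq_conjTranspose,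
      Matrix.conjTranspose_eq_transpose_of_trivial, Function.comp_def] using this
  refine ⟨U, hA.eigenvalues, hUU, hUU', fun p => ?_⟩
  induction p with
  | zero => simp [hUU']
  | succ p ih =>
    calc A ^ (p + 1) = A ^ p * A := pow_succ A p
      _ = (U * diagonal (fun i => hA.eigenvalues i ^ p) * Uᵀ) *
            (U * diagonal hA.eigenvalues * Uᵀ) := by rw [ih]; congr 1
      _ = U * diagonal (fun i => hA.eigenvalues i ^ p) * (Uᵀ * U) *
            diagonal hA.eigenvalues * Uᵀ := by simp only [Matrix.mul_assoc]
      _ = _ := by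
        rw [hUU, Matrix.mul_one, Matrix.mul_assoc U, Matrix.diagonal_mul_diagonal]
        simp only [pow_succ]

/-- Traces of mixed powers of two symmetric matrices are mixed moments of one nonnegative measure
on pairs of eigenvalues (with weights the squared inner products of eigenvectors). This transfers
scalar inequalities to traces, although the matrices need not commute. -/
theorem exists_trace_pow_mul_pow {A B : Matrix n n ℝ} (hA : A.IsHermitian) (hB : B.IsHermitian) :
    ∃ (a b : n → ℝ) (c : n → n → ℝ), (∀ j k, 0 ≤ c j k) ∧
      ∀ p q : ℕ, trace (A ^ p * B ^ q) = ∑ j, ∑ k, a j ^ p * b k ^ q * c j k := by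
  obtain ⟨U, a, -, -, hUA⟩ := exists_pow_eq_orthogonal_conj hA
  obtain ⟨V, b, -, -, hVB⟩ := exists_pow_eq_orthogonal_conj hB
  refine ⟨a, b, fun j k => ((Uᵀ * V) j k) ^ 2, fun j k => sq_nonneg _, fun p q => ?_⟩
  have h : trace (A ^ p * B ^ q) = trace (diagonal (fun i => a i ^ p) * (Uᵀ * V) *
      (diagonal (fun i => b i ^ q) * (Uᵀ * V)ᵀ)) := by
    rw [hUA, hVB, Matrix.mul_assoc U, Matrix.mul_assoc U, Matrix.trace_mul_comm U]
    simp only [Matrix.mul_assoc, Matrix.transpose_mul, Matrix.transpose_transpose]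
  rw [h, trace]
  refine Finset.sum_congr rfl fun j _ => ?_
  rw [diag_apply, Matrix.mul_apply]
  refine Finset.sum_congr rfl fun k _ => ?_
  rw [diagonal_mul, diagonal_mul, transpose_apply]
  ring

theorem pow_mul_pow_add_le_add_pow {x y : ℝ} (hx : 0 ≤ x) (hy : 0 ≤ y) (p q : ℕ) :
    x ^ p * y ^ q + x ^ q * y ^ p ≤ x ^ (p + q) + y ^ (p + q) := by
  have h : 0 ≤ (x ^ p - y ^ p) * (x ^ q - y ^ q) := by
    rcases le_total x y with hxy | hxy
    · exact mul_nonneg_of_nonpos_of_nonpos (sub_nonpos.mpr (pow_le_pow_left₀ hx hxy p))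
        (sub_nonpos.mpr (pow_le_pow_left₀ hx hxy q))
    · exact mul_nonneg (sub_nonneg.mpr (pow_le_pow_left₀ hy hxy p))
        (sub_nonneg.mpr (pow_le_pow_left₀ hy hxy q))
  rw [pow_add, pow_add]
  linarith

theorem sub_mul_pow_sub_pow_le (x y : ℝ) (r : ℕ) (hr : Even r) :
    (x - y) * (x ^ (r + 1) - y ^ (r + 1)) ≤
      ((r + 1 : ℕ) : ℝ) / 2 * ((x - y) ^ 2 * (x ^ r + y ^ r)) := by
  set S : ℝ := ∑ i ∈ Finset.range (r + 1), x ^ i * y ^ (r - i) with hS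
  have h1 : x ^ (r + 1) - y ^ (r + 1) = S * (x - y) := by
    rw [← geom_sum₂_mul]
    simp [hS]
  have h2 : ∑ i ∈ Finset.range (r + 1), x ^ (r - i) * y ^ i = S := by
    rw [hS, ← Finset.sum_range_reflect]
    refine Finset.sum_congr rfl fun i hi => ?_
    have := Finset.mem_range.mp hi
    congr 2; omega
  have h3 : S + S ≤ ((r + 1 : ℕ) : ℝ) * (x ^ r + y ^ r) := by
    calc S + S = ∑ i ∈ Finset.range (r + 1), (x ^ i * y ^ (r - i) + x ^ (r - i) * y ^ i) := by
          rw [Finset.sum_add_distrib, h2]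
      _ ≤ ∑ i ∈ Finset.range (r + 1), (x ^ r + y ^ r) := by
          refine Finset.sum_le_sum fun i hi => ?_
          have hi' := Finset.mem_range.mp hi
          have e : i + (r - i) = r := by omega
          have := pow_mul_pow_add_le_add_pow (abs_nonneg x) (abs_nonneg y) i (r - i)
          rw [e, hr.pow_abs, hr.pow_abs] at this
          refine le_trans ?_ this
          refine add_le_add ?_ ?_
          · rw [← abs_pow, ← abs_pow, ← abs_mul]; exact le_abs_self _
          · rw [← abs_pow, ← abs_pow, ← abs_mul]; exact le_abs_self _
      _ = _ := by simp [mul_add]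
  rw [h1]
  nlinarith [mul_le_mul_of_nonneg_left h3 (sq_nonneg (x - y))]

/-- A mean-value inequality for traces, with an odd power as the monotone function. -/
theorem trace_sub_mul_pow_sub_pow_le {A B : Matrix n n ℝ} (hA : A.IsHermitian)
    (hB : B.IsHermitian) (r : ℕ) (hr : Even r) :
    trace ((A - B) * (A ^ (r + 1) - B ^ (r + 1))) ≤
      ((r + 1 : ℕ) : ℝ) / 2 * trace ((A - B) ^ 2 * (A ^ r + B ^ r)) := by
  obtain ⟨a, b, c, hc, h⟩ := exists_trace_pow_mul_pow hA hB
  have e1 : trace ((A - B) * (A ^ (r + 1) - B ^ (r + 1))) =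
      trace (A ^ (r + 2) * B ^ 0) - trace (A ^ 1 * B ^ (r + 1)) - trace (A ^ (r + 1) * B ^ 1)
        + trace (A ^ 0 * B ^ (r + 2)) := by
    rw [trace_mul_comm (A ^ (r + 1)) (B ^ 1)]
    simp only [Matrix.sub_mul, Matrix.mul_sub, trace_sub, pow_zero, pow_one, Matrix.mul_one,
      Matrix.one_mul, ← pow_succ']
    ring
  have e2 : trace ((A - B) ^ 2 * (A ^ r + B ^ r)) =
      trace (A ^ (r + 2) * B ^ 0) - 2 * trace (A ^ (r + 1) * B ^ 1) + trace (A ^ r * B ^ 2)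
      + (trace (A ^ 2 * B ^ r) - 2 * trace (A ^ 1 * B ^ (r + 1)) +
        trace (A ^ 0 * B ^ (r + 2))) := by
    have f1 : trace (A * B * A ^ r) = trace (A ^ (r + 1) * B) := by
      rw [trace_mul_comm, ← Matrix.mul_assoc, ← pow_succ]
    have f2 : trace (B * A * A ^ r) = trace (A ^ (r + 1) * B) := by
      rw [Matrix.mul_assoc, trace_mul_comm, ← pow_succ']
    have f3 : trace (B * B * A ^ r) = trace (A ^ r * (B * B)) := trace_mul_comm _ _
    have f4 : trace (A * B * B ^ r) = trace (A * B ^ (r + 1)) := by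
      rw [Matrix.mul_assoc, ← pow_succ']
    have f5 : trace (B * A * B ^ r) = trace (A * B ^ (r + 1)) := by
      rw [Matrix.mul_assoc, trace_mul_comm, Matrix.mul_assoc, ← pow_succ]
    have f6 : A * A * A ^ r = A ^ (r + 2) := by rw [← pow_two, ← pow_add, add_comm]
    have f7 : B * B * B ^ r = B ^ (r + 2) := by rw [← pow_two, ← pow_add, add_comm]
    simp only [pow_two, Matrix.sub_mul, Matrix.mul_sub, Matrix.mul_add, trace_sub, trace_add,
      pow_zero, pow_one, Matrix.mul_one, Matrix.one_mul, f1, f2, f3, f4, f5, f6, f7]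
    ring
  rw [e1, e2]
  simp only [h]
  simp only [Finset.mul_sum, ← Finset.sum_sub_distrib, ← Finset.sum_add_distrib]
  refine Finset.sum_le_sum fun j _ => Finset.sum_le_sum fun k _ => ?_
  have := mul_le_mul_of_nonneg_right (sub_mul_pow_sub_pow_le (a j) (b k) r hr) (hc j k)
  calc _ = (a j - b k) * (a j ^ (r + 1) - b k ^ (r + 1)) * c j k := by ring
    _ ≤ _ := this
    _ = _ := by ring

theorem trace_pow_two_mul_nonneg {A : Matrix n n ℝ} (hA : A.IsHermitian) (k : ℕ) :
    0 ≤ trace (A ^ (2 * k)) := by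
  have h := (posSemidef_conjTranspose_mul_self (A ^ k)).trace_nonneg
  rwa [(hA.pow k).eq, ← pow_add, ← two_mul] at h

theorem trace_mul_pow_two_mul_nonneg {P A : Matrix n n ℝ} (hP : P.PosSemidef)
    (hA : A.IsHermitian) (k : ℕ) : 0 ≤ trace (P * A ^ (2 * k)) := by
  have h := (hP.conjTranspose_mul_mul_same (A ^ k)).trace_nonneg
  rwa [(hA.pow k).eq, trace_mul_comm, ← Matrix.mul_assoc, ← pow_add, ← two_mul,
    trace_mul_comm] at h

/-- From `0 ≤ (A - 1) ^ 2 * A ^ (2 * k)`. -/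
theorem trace_pow_odd_le {A : Matrix n n ℝ} (hA : A.IsHermitian) (k : ℕ) :
    trace (A ^ (2 * k + 1)) ≤ (trace (A ^ (2 * k + 2)) + trace (A ^ (2 * k))) / 2 := by
  have hP : ((A - 1) ^ 2).PosSemidef := by
    have := posSemidef_conjTranspose_mul_self (A - 1)
    rwa [(hA.sub isHermitian_one).eq, ← pow_two] at this
  have h := trace_mul_pow_two_mul_nonneg hP hA k
  have e : (A - 1) ^ 2 * A ^ (2 * k) =
      A ^ (2 * k + 2) - (A ^ (2 * k + 1) + A ^ (2 * k + 1)) + A ^ (2 * k) := by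
    rw [pow_two]
    simp only [Matrix.sub_mul, Matrix.mul_sub, Matrix.mul_one, Matrix.one_mul]
    rw [← pow_two, ← pow_add, ← pow_succ', add_comm 2 (2 * k)]
    abel
  rw [e] at h
  simp only [trace_add, trace_sub] at h
  linarith

/-- The scalar bound `(x - y)² ≤ 2 R (x + y)` for `0 ≤ x, y ≤ R`, for positive semidefinite
matrices. -/
theorem posSemidef_two_mul_add_sub_sub_sq {X Y : Matrix n n ℝ} {R : ℝ} (hR : 0 < R)
    (hX : X.PosSemidef) (hY : Y.PosSemidef) (hXR : (R • (1 : Matrix n n ℝ) - X).PosSemidef)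
    (hYR : (R • (1 : Matrix n n ℝ) - Y).PosSemidef) :
    ((2 * R) • (X + Y) - (X - Y) ^ 2).PosSemidef := by
  have key : ∀ {X : Matrix n n ℝ}, X.PosSemidef → (R • (1 : Matrix n n ℝ) - X).PosSemidef →
      (R • X - X ^ 2).PosSemidef := by
    intro X hX hXR
    -- `R (R X - X²) = X (R - X) X + (R - X) X (R - X)`
    have h := ((hXR.conjTranspose_mul_mul_same X).add
      (hX.conjTranspose_mul_mul_same (R • (1 : Matrix n n ℝ) - X))).smul (inv_nonneg.mpr hR.le)
    rw [hX.isHermitian.eq, hXR.isHermitian.eq] at h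
    convert h using 1
    rw [eq_inv_smul_iff₀ hR.ne']
    simp only [Matrix.sub_mul, Matrix.mul_sub, smul_mul_assoc, mul_smul_comm, Matrix.mul_one,
      Matrix.one_mul, smul_sub, smul_smul, pow_two]
    abel
  have h1 := ((key hX hXR).smul (zero_le_two (α := ℝ))).add
    ((key hY hYR).smul (zero_le_two (α := ℝ)))
  have h2 := posSemidef_conjTranspose_mul_self (X + Y)
  rw [(hX.isHermitian.add hY.isHermitian).eq] at h2
  convert h1.add h2 using 1
  simp only [pow_two, Matrix.sub_mul, Matrix.mul_sub, Matrix.add_mul, Matrix.mul_add, smul_sub,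
    smul_add, smul_smul, two_smul]
  abel

end TraceInequalities

/-! ### Moments of sums of independent random matrices -/

section BoundedMeasurable

variable {Ω Ω' : Type*} [MeasurableSpace Ω] [MeasurableSpace Ω']

/-- A bounded measurable real function. -/
def BoundedMeasurable (f : Ω → ℝ) : Prop := Measurable f ∧ ∃ C : ℝ, ∀ ω, |f ω| ≤ C

namespace BoundedMeasurable

theorem const (c : ℝ) : BoundedMeasurable (fun _ : Ω => c) :=
  ⟨measurable_const, |c|, fun _ => le_rfl⟩

variable {f g : Ω → ℝ}

theorem add (hf : BoundedMeasurable f) (hg : BoundedMeasurable g) :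
    BoundedMeasurable (fun ω => f ω + g ω) := by
  obtain ⟨hf, C, hC⟩ := hf
  obtain ⟨hg, D, hD⟩ := hg
  exact ⟨hf.add hg, C + D, fun ω => (abs_add_le _ _).trans (add_le_add (hC ω) (hD ω))⟩

theorem mul (hf : BoundedMeasurable f) (hg : BoundedMeasurable g) :
    BoundedMeasurable (fun ω => f ω * g ω) := by
  obtain ⟨hf, C, hC⟩ := hf
  obtain ⟨hg, D, hD⟩ := hg
  refine ⟨hf.mul hg, C * D, fun ω => ?_⟩
  rw [abs_mul]
  exact mul_le_mul (hC ω) (hD ω) (abs_nonneg _) ((abs_nonneg _).trans (hC ω))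

theorem sub (hf : BoundedMeasurable f) (hg : BoundedMeasurable g) :
    BoundedMeasurable (fun ω => f ω - g ω) := by
  simpa [sub_eq_add_neg] using hf.add ((const (-1)).mul hg)

theorem sum {ι : Type*} (s : Finset ι) {f : ι → Ω → ℝ} (hf : ∀ i ∈ s, BoundedMeasurable (f i)) :
    BoundedMeasurable (fun ω => ∑ i ∈ s, f i ω) := by
  classical
  induction s using Finset.induction_on with
  | empty => simpa using const 0
  | insert i s hi ih =>
    simp only [Finset.sum_insert hi]
    exact (hf i (Finset.mem_insert_self i s)).add
      (ih fun j hj => hf j (Finset.mem_insert_of_mem hj))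

theorem comp (hf : BoundedMeasurable f) {φ : Ω' → Ω} (hφ : Measurable φ) :
    BoundedMeasurable (fun ω => f (φ ω)) :=
  ⟨hf.1.comp hφ, hf.2.imp fun _ h ω => h (φ ω)⟩

theorem integrable (hf : BoundedMeasurable f) (μ : Measure Ω) [IsFiniteMeasure μ] :
    Integrable f μ := by
  obtain ⟨hf, C, hC⟩ := hf
  exact Integrable.of_bound hf.aestronglyMeasurable C (Filter.Eventually.of_forall hC)

theorem integral_comp (hf : BoundedMeasurable f) {φ : Ω' → Ω} {μ : Measure Ω'} {ν : Measure Ω}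
    (hφ : MeasurePreserving φ μ ν) : ∫ ω, f (φ ω) ∂μ = ∫ ω, f ω ∂ν := by
  rw [← hφ.map_eq, integral_map hφ.aemeasurable hf.1.aestronglyMeasurable]

end BoundedMeasurable

variable {n : Type*}

/-- A random matrix with bounded measurable entries. -/
def BoundedMeasurableMatrix (W : Ω → Matrix n n ℝ) : Prop :=
  ∀ a b, BoundedMeasurable (fun ω => W ω a b)

namespace BoundedMeasurableMatrix

variable {W W' : Ω → Matrix n n ℝ}

theorem const (M : Matrix n n ℝ) : BoundedMeasurableMatrix (fun _ : Ω => M) :=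
  fun _ _ => .const _

theorem add (h : BoundedMeasurableMatrix W) (h' : BoundedMeasurableMatrix W') :
    BoundedMeasurableMatrix (fun ω => W ω + W' ω) := fun a b => (h a b).add (h' a b)

theorem sub (h : BoundedMeasurableMatrix W) (h' : BoundedMeasurableMatrix W') :
    BoundedMeasurableMatrix (fun ω => W ω - W' ω) := fun a b => (h a b).sub (h' a b)

theorem sum {ι : Type*} (s : Finset ι) {W : ι → Ω → Matrix n n ℝ}
    (h : ∀ i ∈ s, BoundedMeasurableMatrix (W i)) :
    BoundedMeasurableMatrix (fun ω => ∑ i ∈ s, W i ω) := by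
  intro a b
  simp only [Matrix.sum_apply]
  exact .sum s fun i hi => h i hi a b

theorem comp (h : BoundedMeasurableMatrix W) {φ : Ω' → Ω} (hφ : Measurable φ) :
    BoundedMeasurableMatrix (fun ω => W (φ ω)) := fun a b => (h a b).comp hφ

variable [Fintype n]

theorem mul (h : BoundedMeasurableMatrix W) (h' : BoundedMeasurableMatrix W') :
    BoundedMeasurableMatrix (fun ω => W ω * W' ω) := by
  intro a b
  simp only [Matrix.mul_apply]
  exact .sum _ fun i _ => (h a i).mul (h' i b)

theorem trace (h : BoundedMeasurableMatrix W) : BoundedMeasurable (fun ω => (W ω).trace) :=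
  .sum _ fun i _ => h i i

theorem pow [DecidableEq n] (h : BoundedMeasurableMatrix W) (k : ℕ) :
    BoundedMeasurableMatrix (fun ω => W ω ^ k) := by
  induction k with
  | zero => simpa using const 1
  | succ k ih => simpa only [pow_succ] using ih.mul h

end BoundedMeasurableMatrix

/-- The entrywise expectation of a random matrix. -/
noncomputable def meanMatrix (μ : Measure Ω) (W : Ω → Matrix n n ℝ) : Matrix n n ℝ :=
  Matrix.of fun a b => ∫ ω, W ω a b ∂μ

theorem integral_trace_mul_of_independent [Fintype n] {μ : Measure Ω} {ν : Measure Ω'}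
    [IsProbabilityMeasure μ] [IsProbabilityMeasure ν] {W : Ω → Matrix n n ℝ}
    {Y : Ω' → Matrix n n ℝ} (hW : BoundedMeasurableMatrix W) (hY : BoundedMeasurableMatrix Y) :
    ∫ z, (Y z.2 * W z.1).trace ∂(μ.prod ν) = ∫ ω, (meanMatrix ν Y * W ω).trace ∂μ := by
  have h1 : ∀ a b, Integrable (fun z : Ω × Ω' => Y z.2 a b * W z.1 b a) (μ.prod ν) := fun a b =>
    (((hY a b).comp measurable_snd).mul ((hW b a).comp measurable_fst)).integrable _
  have h2 : ∀ a b, Integrable (fun ω => meanMatrix ν Y a b * W ω b a) μ := fun a b =>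
    ((BoundedMeasurable.const _).mul (hW b a)).integrable _
  simp only [Matrix.trace, Matrix.diag_apply, Matrix.mul_apply]
  rw [integral_finsetSum _ fun a _ => integrable_finsetSum _ fun b _ => h1 a b,
    integral_finsetSum _ fun a _ => integrable_finsetSum _ fun b _ => h2 a b]
  refine Finset.sum_congr rfl fun a _ => ?_
  rw [integral_finsetSum _ fun b _ => h1 a b, integral_finsetSum _ fun b _ => h2 a b]
  refine Finset.sum_congr rfl fun b _ => ?_
  simp only [mul_comm (Y _ a b)]
  rw [integral_prod_mul (fun ω => W ω b a) (fun ω => Y ω a b), integral_const_mul, mul_comm]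
  rfl

end BoundedMeasurable

section Swap

variable {ι Ω : Type*}

open Classical in
/-- Exchange the `i`-th coordinates of two configurations. -/
noncomputable def swapAt (i : ι) (z : (ι → Ω) × (ι → Ω)) : (ι → Ω) × (ι → Ω) :=
  (fun j => if j = i then z.2 j else z.1 j, fun j => if j = i then z.1 j else z.2 j)

theorem measurePreserving_swapAt [Fintype ι] [MeasurableSpace Ω] (μ : ι → Measure Ω)
    [∀ i, IsProbabilityMeasure (μ i)] (i : ι) :
    MeasurePreserving (swapAt i) ((Measure.pi μ).prod (Measure.pi μ))
      ((Measure.pi μ).prod (Measure.pi μ)) := by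
  classical
  have h := measurePreserving_arrowProdEquivProdArrow Ω Ω ι μ μ
  have h' := measurePreserving_pi (fun i => (μ i).prod (μ i)) (fun i => (μ i).prod (μ i))
    (f := fun j => if j = i then Prod.swap else id) (fun j => by
      split_ifs
      · exact Measure.measurePreserving_swap
      · exact MeasurePreserving.id _)
  have := h.comp (h'.comp (h.symm _))
  convert this using 1
  funext z
  ext j <;>
  · by_cases hj : j = i <;>
      simp [swapAt, MeasurableEquiv.arrowProdEquivProdArrow, Equiv.arrowProdEquivProdArrow, hj]

end Swap

section Moments

open Matrix

variable {ι Ω n : Type*} [Fintype ι] [MeasurableSpace Ω]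
  {μ : ι → Measure Ω} {X : ι → Ω → Matrix n n ℝ} {R : ℝ}

/-- The sum of the random matrices `X i (ω i)`, centered by its expectation. -/
noncomputable def centeredSum (μ : ι → Measure Ω) (X : ι → Ω → Matrix n n ℝ) (ω : ι → Ω) :
    Matrix n n ℝ :=
  ∑ i, (X i (ω i) - meanMatrix (μ i) (X i))

theorem boundedMeasurableMatrix_centeredSum (hX : ∀ i, BoundedMeasurableMatrix (X i)) :
    BoundedMeasurableMatrix (centeredSum μ X) :=
  .sum _ fun i _ => ((hX i).comp (measurable_pi_apply i)).sub (.const _)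

theorem isHermitian_centeredSum (hX : ∀ i ω, (X i ω).IsHermitian) (ω : ι → Ω) :
    (centeredSum μ X ω).IsHermitian := by
  refine isSelfAdjoint_sum _ fun i _ => IsHermitian.sub (hX i _) ?_
  ext a b
  simp only [conjTranspose_apply, meanMatrix, of_apply, star_trivial]
  refine integral_congr_ae (Filter.Eventually.of_forall fun ω => ?_)
  simpa using (hX i ω).apply a b

theorem centeredSum_swapAt (i : ι) (z : (ι → Ω) × (ι → Ω)) :
    centeredSum μ X z.1 - centeredSum μ X (swapAt i z).1 = X i (z.1 i) - X i (z.2 i) := by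
  classical
  simp only [centeredSum]
  rw [← Finset.sum_sub_distrib, Finset.sum_eq_single i]
  · simp [swapAt]
  · intro j _ hj
    simp [swapAt, hj]
  · simp

variable [Fintype n] [DecidableEq n] [∀ i, IsProbabilityMeasure (μ i)]

/-- One summand of the moment recursion. Exchanging the `i`-th sample with an independent copy
antisymmetrizes the trace, which turns the odd power into a difference; the mean-value inequality
then leaves the square of the difference of two samples, which is dominated by the samples
themselves. -/
theorem integral_trace_sub_mean_mul_centeredSum_pow_le (hR : 0 < R)
    (hX : ∀ i, BoundedMeasurableMatrix (X i)) (hpos : ∀ i ω, (X i ω).PosSemidef)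
    (hle : ∀ i ω, (R • (1 : Matrix n n ℝ) - X i ω).PosSemidef) (k : ℕ) (i : ι) :
    ∫ ω, ((X i (ω i) - meanMatrix (μ i) (X i)) * centeredSum μ X ω ^ (2 * k + 1)).trace
        ∂(Measure.pi μ) ≤
      (2 * k + 1) * R *
        ∫ ω, ((X i (ω i) + meanMatrix (μ i) (X i)) * centeredSum μ X ω ^ (2 * k)).trace
          ∂(Measure.pi μ) := by
  set Z := centeredSum μ X with hZdef
  set P := Measure.pi μ with hP
  have hZ : BoundedMeasurableMatrix Z := boundedMeasurableMatrix_centeredSum hX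
  have hZh : ∀ ω, (Z ω).IsHermitian := isHermitian_centeredSum fun i ω => (hpos i ω).isHermitian
  have hXi : BoundedMeasurableMatrix (fun ω : ι → Ω => X i (ω i)) :=
    (hX i).comp (measurable_pi_apply i)
  have hmean : meanMatrix P (fun ω => X i (ω i)) = meanMatrix (μ i) (X i) := by
    ext a b
    exact (hX i a b).integral_comp (measurePreserving_eval μ i)
  have hswap := measurePreserving_swapAt μ i
  -- an average over an independent copy of the `i`-th sample
  have copy : ∀ (s : ℝ) {W : (ι → Ω) → Matrix n n ℝ}, BoundedMeasurableMatrix W →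
      ∫ z, (X i (z.1 i) * W z.1).trace + s * (X i (z.2 i) * W z.1).trace ∂(P.prod P) =
        ∫ ω, (X i (ω i) * W ω).trace + s * (meanMatrix (μ i) (X i) * W ω).trace ∂P := by
    intro s W hW
    have b1 := (hXi.mul hW).trace
    have b2 : BoundedMeasurable (fun z : (ι → Ω) × (ι → Ω) => (X i (z.2 i) * W z.1).trace) :=
      ((hXi.comp measurable_snd).mul (hW.comp measurable_fst)).trace
    have b3 : BoundedMeasurable (fun ω => (meanMatrix (μ i) (X i) * W ω).trace) :=
      ((BoundedMeasurableMatrix.const _).mul hW).trace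
    rw [integral_add ((b1.comp measurable_fst).integrable _)
        (((BoundedMeasurable.const s).mul b2).integrable _),
      integral_add (b1.integrable _) (((BoundedMeasurable.const s).mul b3).integrable _),
      integral_const_mul, integral_const_mul, integral_trace_mul_of_independent hW hXi, hmean,
      b1.integral_comp measurePreserving_fst]
  set D : (ι → Ω) × (ι → Ω) → Matrix n n ℝ := fun z => X i (z.1 i) - X i (z.2 i) with hD
  have hDb : BoundedMeasurableMatrix D :=
    (hXi.comp measurable_fst).sub (hXi.comp measurable_snd)
  have hDswap : ∀ z, D (swapAt i z) = -D z := by intro z; simp [hD, swapAt]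
  have hZ1 : BoundedMeasurableMatrix (fun z : (ι → Ω) × (ι → Ω) => Z z.1) :=
    hZ.comp measurable_fst
  have bg : BoundedMeasurable (fun z => (D z * Z z.1 ^ (2 * k + 1)).trace) :=
    (hDb.mul (hZ1.pow _)).trace
  have bh : BoundedMeasurable (fun z => (D z ^ 2 * Z z.1 ^ (2 * k)).trace) :=
    ((hDb.pow 2).mul (hZ1.pow _)).trace
  have step1 : ∫ ω, ((X i (ω i) - meanMatrix (μ i) (X i)) * Z ω ^ (2 * k + 1)).trace ∂P =
      ∫ z, (D z * Z z.1 ^ (2 * k + 1)).trace ∂(P.prod P) := by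
    have := copy (-1) (hZ.pow (2 * k + 1))
    simp only [neg_one_mul, ← sub_eq_add_neg, ← trace_sub, ← Matrix.sub_mul] at this
    exact this.symm
  have step2 : (2 : ℝ) * ∫ z, (D z * Z z.1 ^ (2 * k + 1)).trace ∂(P.prod P) ≤
      (2 * k + 1) * ∫ z, (D z ^ 2 * Z z.1 ^ (2 * k)).trace ∂(P.prod P) := by
    have e1 := bg.integral_comp hswap
    have e2 := bh.integral_comp hswap
    calc (2 : ℝ) * ∫ z, (D z * Z z.1 ^ (2 * k + 1)).trace ∂(P.prod P)
        = ∫ z, ((D z * Z z.1 ^ (2 * k + 1)).trace +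
            (D (swapAt i z) * Z (swapAt i z).1 ^ (2 * k + 1)).trace) ∂(P.prod P) := by
          rw [integral_add (bg.integrable _) ((bg.comp hswap.measurable).integrable _), e1]
          ring
      _ ≤ ∫ z, ((2 * k + 1) / 2 : ℝ) * ((D z ^ 2 * Z z.1 ^ (2 * k)).trace +
            (D (swapAt i z) ^ 2 * Z (swapAt i z).1 ^ (2 * k)).trace) ∂(P.prod P) := by
          refine integral_mono ((bg.add (bg.comp hswap.measurable)).integrable _)
            (((BoundedMeasurable.const _).mul
              (bh.add (bh.comp hswap.measurable))).integrable _) fun z => ?_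
          have := trace_sub_mul_pow_sub_pow_le (hZh z.1) (hZh (swapAt i z).1) (2 * k)
            (even_two_mul k)
          rw [centeredSum_swapAt] at this
          simp only [hDswap, Matrix.neg_mul, trace_neg, neg_sq, ← sub_eq_add_neg, ← trace_sub,
            ← Matrix.mul_sub, ← trace_add, ← Matrix.mul_add]
          push_cast at this
          exact this
      _ = _ := by
          rw [integral_const_mul, integral_add (bh.integrable _)
            ((bh.comp hswap.measurable).integrable _), e2]
          ring
  have step3 : ∫ z, (D z ^ 2 * Z z.1 ^ (2 * k)).trace ∂(P.prod P) ≤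
      2 * R * ∫ ω, ((X i (ω i) + meanMatrix (μ i) (X i)) * Z ω ^ (2 * k)).trace ∂P := by
    have e := copy 1 (hZ.pow (2 * k))
    simp only [one_mul, ← trace_add, ← Matrix.add_mul] at e
    rw [← e, ← integral_const_mul]
    refine integral_mono (bh.integrable _) (((BoundedMeasurable.const _).mul
      ((((hXi.comp measurable_fst).add (hXi.comp measurable_snd)).mul
        (hZ1.pow _)).trace)).integrable _) fun z => ?_
    have := trace_mul_pow_two_mul_nonneg (posSemidef_two_mul_add_sub_sub_sq hR (hpos i (z.1 i))
      (hpos i (z.2 i)) (hle i _) (hle i _)) (hZh z.1) k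
    rw [Matrix.sub_mul, trace_sub, smul_mul_assoc, trace_smul, smul_eq_mul] at this
    exact sub_nonneg.mp this
  rw [step1]
  have hk : (0 : ℝ) ≤ 2 * k + 1 := by positivity
  nlinarith [mul_le_mul_of_nonneg_left step3 hk]

/-- The recursion between consecutive even moments. -/
theorem integral_trace_centeredSum_pow_succ_le (hR : 0 < R)
    (hX : ∀ i, BoundedMeasurableMatrix (X i)) (hpos : ∀ i ω, (X i ω).PosSemidef)
    (hle : ∀ i ω, (R • (1 : Matrix n n ℝ) - X i ω).PosSemidef)
    (hmean : (1 - ∑ i, meanMatrix (μ i) (X i)).PosSemidef) (k : ℕ) (hk : (2 * k + 1) * R ≤ 1) :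
    ∫ ω, (centeredSum μ X ω ^ (2 * (k + 1))).trace ∂(Measure.pi μ) ≤
      10 * (k + 1) * R * ∫ ω, (centeredSum μ X ω ^ (2 * k)).trace ∂(Measure.pi μ) := by
  set Z := centeredSum μ X with hZdef
  set P := Measure.pi μ with hP
  have hZ : BoundedMeasurableMatrix Z := boundedMeasurableMatrix_centeredSum hX
  have hZh : ∀ ω, (Z ω).IsHermitian := isHermitian_centeredSum fun i ω => (hpos i ω).isHermitian
  have hXi : ∀ i, BoundedMeasurableMatrix (fun ω : ι → Ω => X i (ω i)) := fun i =>
    (hX i).comp (measurable_pi_apply i)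
  have b0 := (hZ.pow (2 * k)).trace
  have b2 := (hZ.pow (2 * (k + 1))).trace
  set M := ∑ i, meanMatrix (μ i) (X i) with hM
  set m0 := ∫ ω, (Z ω ^ (2 * k)).trace ∂P with hm0
  set m2 := ∫ ω, (Z ω ^ (2 * (k + 1))).trace ∂P with hm2
  have hm0n : 0 ≤ m0 := integral_nonneg fun ω => trace_pow_two_mul_nonneg (hZh ω) k
  have hm2n : 0 ≤ m2 := integral_nonneg fun ω => trace_pow_two_mul_nonneg (hZh ω) (k + 1)
  have h1 : m2 ≤ (2 * k + 1) * R * ∫ ω, ((Z ω + (2 : ℝ) • M) * Z ω ^ (2 * k)).trace ∂P := by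
    calc m2 = ∫ ω, ∑ i, ((X i (ω i) - meanMatrix (μ i) (X i)) * Z ω ^ (2 * k + 1)).trace ∂P := by
          refine integral_congr_ae (Filter.Eventually.of_forall fun ω => ?_)
          simp only
          rw [← trace_sum, ← Finset.sum_mul, show 2 * (k + 1) = 2 * k + 1 + 1 by ring,
            pow_succ' (Z ω) (2 * k + 1)]
          rfl
      _ = ∑ i, ∫ ω, ((X i (ω i) - meanMatrix (μ i) (X i)) * Z ω ^ (2 * k + 1)).trace ∂P :=
          integral_finsetSum _ fun i _ =>
            (((hXi i).sub (.const _)).mul (hZ.pow _)).trace.integrable _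
      _ ≤ ∑ i, (2 * k + 1) * R *
            ∫ ω, ((X i (ω i) + meanMatrix (μ i) (X i)) * Z ω ^ (2 * k)).trace ∂P :=
          Finset.sum_le_sum fun i _ =>
            integral_trace_sub_mean_mul_centeredSum_pow_le hR hX hpos hle k i
      _ = _ := by
          rw [← Finset.mul_sum, ← integral_finsetSum _ fun i _ =>
            (((hXi i).add (.const _)).mul (hZ.pow _)).trace.integrable _]
          congr 1
          refine integral_congr_ae (Filter.Eventually.of_forall fun ω => ?_)
          simp only
          rw [← trace_sum, ← Finset.sum_mul]
          congr 2
          rw [hZdef, centeredSum, Finset.sum_add_distrib, Finset.sum_sub_distrib, ← hM, two_smul]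
          abel
  have h2 : ∫ ω, ((Z ω + (2 : ℝ) • M) * Z ω ^ (2 * k)).trace ∂P ≤
      ∫ ω, ((1 / 2 : ℝ) * (Z ω ^ (2 * (k + 1))).trace + (5 / 2) * (Z ω ^ (2 * k)).trace) ∂P := by
    refine integral_mono (((hZ.add (.const _)).mul (hZ.pow _)).trace.integrable _)
      ((((BoundedMeasurable.const _).mul b2).add ((BoundedMeasurable.const _).mul b0)).integrable _)
      fun ω => ?_
    have e1 := trace_pow_odd_le (hZh ω) k
    have e2 := trace_mul_pow_two_mul_nonneg hmean (hZh ω) k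
    rw [Matrix.sub_mul, Matrix.one_mul, trace_sub] at e2
    simp only [Matrix.add_mul, ← pow_succ', trace_add, smul_mul_assoc, trace_smul, smul_eq_mul,
      mul_add, mul_one]
    linarith
  rw [integral_add (((BoundedMeasurable.const _).mul b2).integrable _)
    (((BoundedMeasurable.const _).mul b0).integrable _), integral_const_mul,
    integral_const_mul] at h2
  have hc : 0 ≤ (2 * (k : ℝ) + 1) * R := by positivity
  have h3 := h1.trans (mul_le_mul_of_nonneg_left h2 hc)
  have h4 : (2 * (k : ℝ) + 1) * R * m2 ≤ 1 * m2 := mul_le_mul_of_nonneg_right hk hm2n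
  have h5 : 0 ≤ R * m0 := mul_nonneg hR.le hm0n
  nlinarith

theorem integral_trace_centeredSum_pow_le (hR : 0 < R)
    (hX : ∀ i, BoundedMeasurableMatrix (X i)) (hpos : ∀ i ω, (X i ω).PosSemidef)
    (hle : ∀ i ω, (R • (1 : Matrix n n ℝ) - X i ω).PosSemidef)
    (hmean : (1 - ∑ i, meanMatrix (μ i) (X i)).PosSemidef) (K : ℕ) (hK : 2 * K * R ≤ 1) :
    ∫ ω, (centeredSum μ X ω ^ (2 * K)).trace ∂(Measure.pi μ) ≤
      Fintype.card n * (10 * K * R) ^ K := by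
  have h : ∀ k ≤ K, ∫ ω, (centeredSum μ X ω ^ (2 * k)).trace ∂(Measure.pi μ) ≤
      Fintype.card n * (10 * K * R) ^ k := by
    intro k
    induction k with
    | zero => intro _; simp
    | succ k ih =>
      intro hk
      have hk' : ((k : ℝ) + 1) ≤ K := by exact_mod_cast hk
      refine (integral_trace_centeredSum_pow_succ_le hR hX hpos hle hmean k ?_).trans ?_
      · nlinarith
      · have h1 := ih (by omega)
        have h2 : 0 ≤ 10 * ((k : ℝ) + 1) * R := by positivity
        have h3 : 10 * ((k : ℝ) + 1) * R ≤ 10 * K * R := by nlinarith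
        calc _ ≤ 10 * ((k : ℝ) + 1) * R * (Fintype.card n * (10 * K * R) ^ k) :=
              mul_le_mul_of_nonneg_left h1 h2
          _ ≤ 10 * K * R * (Fintype.card n * (10 * K * R) ^ k) :=
              mul_le_mul_of_nonneg_right h3 (by positivity)
          _ = _ := by ring
  exact h K le_rfl

end Moments

/-! ### Concentration of sums of independent positive semidefinite matrices -/

section Concentration

open Matrix

variable {n : Type*} [Fintype n]

theorem dotProduct_transpose_mul_mul_mulVec {m : Type*} [Fintype m] (A : Matrix m m ℝ)
    (V : Matrix m n ℝ) (x : n → ℝ) :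
    x ⬝ᵥ (Vᵀ * A * V) *ᵥ x = (V *ᵥ x) ⬝ᵥ A *ᵥ (V *ᵥ x) := by
  rw [← Matrix.mulVec_mulVec, ← Matrix.mulVec_mulVec, Matrix.dotProduct_mulVec x Vᵀ,
    Matrix.vecMul_transpose]

theorem abs_dotProduct_mulVec_le_of_trace_pow_le [DecidableEq n] {A : Matrix n n ℝ}
    (hA : A.IsHermitian) {K : ℕ} (hK : K ≠ 0) {ε : ℝ} (hε : 0 ≤ ε)
    (h : trace (A ^ (2 * K)) ≤ ε ^ (2 * K)) (y : n → ℝ) :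
    |y ⬝ᵥ A *ᵥ y| ≤ ε * (y ⬝ᵥ y) := by
  obtain ⟨U, a, hU, hU', hp⟩ := exists_pow_eq_orthogonal_conj hA
  have htr : trace (A ^ (2 * K)) = ∑ j, a j ^ (2 * K) := by
    rw [hp, trace_mul_comm, ← Matrix.mul_assoc, hU, Matrix.one_mul, trace_diagonal]
  have ha : ∀ j, |a j| ≤ ε := by
    intro j
    refine le_of_pow_le_pow_left₀ (n := 2 * K) (by omega) hε ?_
    rw [(even_two_mul K).pow_abs]
    refine le_trans ?_ (htr ▸ h)
    exact Finset.single_le_sum (f := fun j => a j ^ (2 * K))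
      (fun i _ => (even_two_mul K).pow_nonneg _) (Finset.mem_univ j)
  have hq : ∀ d : n → ℝ, y ⬝ᵥ (U * diagonal d * Uᵀ) *ᵥ y = ∑ j, d j * (Uᵀ *ᵥ y) j ^ 2 := by
    intro d
    have := dotProduct_transpose_mul_mul_mulVec (diagonal d) Uᵀ y
    rw [transpose_transpose] at this
    rw [this, dotProduct]
    refine Finset.sum_congr rfl fun j _ => ?_
    rw [mulVec_diagonal]
    ring
  have h1 : y ⬝ᵥ A *ᵥ y = ∑ j, a j * (Uᵀ *ᵥ y) j ^ 2 := by
    rw [← hq]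
    simpa using congrArg (fun M => y ⬝ᵥ M *ᵥ y) (hp 1)
  have h2 : y ⬝ᵥ y = ∑ j, (Uᵀ *ᵥ y) j ^ 2 := by
    have := hq (fun _ => 1)
    simpa [hU'] using this
  rw [h1, h2, Finset.mul_sum]
  refine (Finset.abs_sum_le_sum_abs _ _).trans (Finset.sum_le_sum fun j _ => ?_)
  rw [abs_mul, abs_sq]
  exact mul_le_mul_of_nonneg_right (ha j) (sq_nonneg _)

/-- A square root `N` and a pseudo-inverse square root `V` of a positive semidefinite matrix. In an
eigenbasis `V` has the entries `(√a)⁻¹`, where the convention `0⁻¹ = 0` takes care of the kernel. -/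
theorem exists_whitening [DecidableEq n] {S : Matrix n n ℝ} (hS : S.PosSemidef) :
    ∃ V N : Matrix n n ℝ, (1 - Vᵀ * S * V).PosSemidef ∧ S = Nᵀ * N ∧ S * (1 - V * N) = 0 := by
  obtain ⟨U, a, hU, hU', hp⟩ := exists_pow_eq_orthogonal_conj hS.isHermitian
  have hS1 : S = U * diagonal a * Uᵀ := by simpa using hp 1
  have hdiag : Uᵀ * S * U = diagonal a := by
    rw [hS1]
    calc _ = (Uᵀ * U) * diagonal a * (Uᵀ * U) := by simp only [Matrix.mul_assoc]
      _ = _ := by rw [hU, Matrix.one_mul, Matrix.mul_one]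
  have ha : ∀ j, 0 ≤ a j := by
    intro j
    have := (hS.conjTranspose_mul_mul_same U).diag_nonneg (i := j)
    rwa [conjTranspose_eq_transpose_of_trivial, hdiag, diagonal_apply_eq] at this
  refine ⟨U * diagonal (fun j => (√(a j))⁻¹), diagonal (fun j => √(a j)) * Uᵀ, ?_, ?_, ?_⟩
  · have e : (U * diagonal (fun j => (√(a j))⁻¹))ᵀ * S * (U * diagonal (fun j => (√(a j))⁻¹)) =
        diagonal (fun j => (√(a j))⁻¹ * a j * (√(a j))⁻¹) := by
      rw [transpose_mul, diagonal_transpose]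
      calc _ = diagonal (fun j => (√(a j))⁻¹) * (Uᵀ * S * U) * diagonal (fun j => (√(a j))⁻¹) := by
            simp only [Matrix.mul_assoc]
        _ = _ := by rw [hdiag, diagonal_mul_diagonal, diagonal_mul_diagonal]
    rw [e, ← diagonal_one, diagonal_sub]
    refine posSemidef_diagonal_iff.mpr fun j => ?_
    rw [mul_right_comm, ← mul_inv, Real.mul_self_sqrt (ha j), sub_nonneg]
    exact inv_mul_le_one
  · rw [transpose_mul, diagonal_transpose, transpose_transpose]
    calc S = U * diagonal (fun j => √(a j) * √(a j)) * Uᵀ := by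
          simp only [Real.mul_self_sqrt (ha _)]
          exact hS1
      _ = _ := by rw [← diagonal_mul_diagonal]; simp only [Matrix.mul_assoc]
  · rw [Matrix.mul_sub, Matrix.mul_one, sub_eq_zero]
    calc S = U * diagonal (fun j => a j * ((√(a j))⁻¹ * √(a j))) * Uᵀ := by
          conv_lhs => rw [hS1]
          congr 3
          funext j
          rcases (ha j).eq_or_lt with h0 | h0
          · simp [← h0]
          · rw [inv_mul_cancel₀ (Real.sqrt_pos.mpr h0).ne', mul_one]
      _ = U * diagonal a * (Uᵀ * U) * diagonal (fun j => (√(a j))⁻¹) *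
            diagonal (fun j => √(a j)) * Uᵀ := by
          rw [hU, Matrix.mul_one, ← diagonal_mul_diagonal, ← diagonal_mul_diagonal]
          simp only [Matrix.mul_assoc]
      _ = _ := by
          conv_rhs => rw [hS1]
          simp only [Matrix.mul_assoc]

theorem meanMatrix_conj {Ω : Type*} [MeasurableSpace Ω] {μ : Measure Ω} [IsProbabilityMeasure μ]
    {X : Ω → Matrix n n ℝ} (hX : BoundedMeasurableMatrix X) (V : Matrix n n ℝ) :
    meanMatrix μ (fun ω => Vᵀ * X ω * V) = Vᵀ * meanMatrix μ X * V := by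
  ext a b
  have i1 : ∀ c d, Integrable (fun ω => V d a * X ω d c * V c b) μ := fun c d =>
    (((BoundedMeasurable.const _).mul (hX d c)).mul (.const _)).integrable _
  simp only [meanMatrix, of_apply, Matrix.mul_apply, transpose_apply, Finset.sum_mul]
  rw [integral_finsetSum _ fun c _ => integrable_finsetSum _ fun d _ => i1 c d]
  refine Finset.sum_congr rfl fun c _ => ?_
  rw [integral_finsetSum _ fun d _ => i1 c d]
  refine Finset.sum_congr rfl fun d _ => ?_
  rw [integral_mul_const, integral_const_mul]

/-- A sum of independent random positive semidefinite matrices with mean `S`, each dominated by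
`R • S`, approximates `S` spectrally; the failure probability comes from Markov's inequality for the
trace of the `2K`-th power of the whitened deviation. -/
theorem one_sub_le_measureReal_forall_abs_dotProduct_sub_le {ι Ω : Type*} [Fintype ι]
    [MeasurableSpace Ω] {μ : ι → Measure Ω} [∀ i, IsProbabilityMeasure (μ i)]
    {X : ι → Ω → Matrix n n ℝ} {S : Matrix n n ℝ} {R ε : ℝ} (hR : 0 < R) (hε : 0 < ε)
    (hX : ∀ i, BoundedMeasurableMatrix (X i)) (hpos : ∀ i ω, (X i ω).PosSemidef)
    (hle : ∀ i ω, (R • S - X i ω).PosSemidef) (hS : S.PosSemidef)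
    (hmean : ∑ i, meanMatrix (μ i) (X i) = S) {K : ℕ} (hK : K ≠ 0) (hKR : 2 * K * R ≤ 1) :
    1 - Fintype.card n * (10 * K * R / ε ^ 2) ^ K ≤
      (Measure.pi μ).real {ω | ∀ x : n → ℝ,
        |x ⬝ᵥ (∑ i, X i (ω i)) *ᵥ x - x ⬝ᵥ S *ᵥ x| ≤ ε * (x ⬝ᵥ S *ᵥ x)} := by
  classical
  obtain ⟨V, N, hV, hN, hVN⟩ := exists_whitening hS
  set Y : ι → Ω → Matrix n n ℝ := fun i ω => Vᵀ * X i ω * V with hY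
  have hYb : ∀ i, BoundedMeasurableMatrix (Y i) := fun i =>
    ((BoundedMeasurableMatrix.const _).mul (hX i)).mul (.const _)
  have hYpos : ∀ i ω, (Y i ω).PosSemidef := fun i ω => by
    have := (hpos i ω).conjTranspose_mul_mul_same V
    rwa [conjTranspose_eq_transpose_of_trivial] at this
  have hYle : ∀ i ω, (R • (1 : Matrix n n ℝ) - Y i ω).PosSemidef := fun i ω => by
    have h1 := (hle i ω).conjTranspose_mul_mul_same V
    rw [conjTranspose_eq_transpose_of_trivial] at h1
    have h2 := (hV.smul hR.le).add h1
    convert h2 using 1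
    simp only [hY, smul_sub, Matrix.mul_sub, Matrix.sub_mul, mul_smul_comm, smul_mul_assoc]
    abel
  have hYsum : ∑ i, meanMatrix (μ i) (Y i) = Vᵀ * S * V := by
    simp only [hY, meanMatrix_conj (hX _), ← hmean, Finset.mul_sum, Finset.sum_mul]
  have hZ : BoundedMeasurableMatrix (centeredSum μ Y) := boundedMeasurableMatrix_centeredSum hYb
  have hZh := isHermitian_centeredSum (μ := μ) fun i ω => (hYpos i ω).isHermitian
  have hmom := integral_trace_centeredSum_pow_le hR hYb hYpos hYle (hYsum ▸ hV) K hKR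
  have htrb := (hZ.pow (2 * K)).trace
  have hmarkov := mul_meas_ge_le_integral_of_nonneg (μ := Measure.pi μ)
    (Filter.Eventually.of_forall fun ω => trace_pow_two_mul_nonneg (hZh ω) K)
    (htrb.integrable _) (ε ^ (2 * K))
  set B : Set (ι → Ω) := {ω | ε ^ (2 * K) ≤ (centeredSum μ Y ω ^ (2 * K)).trace} with hB
  have hBm : MeasurableSet B := measurableSet_le measurable_const htrb.1
  have hBle : (Measure.pi μ).real B ≤ Fintype.card n * (10 * K * R / ε ^ 2) ^ K := by
    have hpow : 0 < ε ^ (2 * K) := by positivity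
    rw [div_pow, ← pow_mul, ← mul_div_assoc, le_div_iff₀ hpow, mul_comm]
    exact hmarkov.trans hmom
  have hsub : Bᶜ ⊆ {ω | ∀ x : n → ℝ,
      |x ⬝ᵥ (∑ i, X i (ω i)) *ᵥ x - x ⬝ᵥ S *ᵥ x| ≤ ε * (x ⬝ᵥ S *ᵥ x)} := by
    intro ω hω x
    have htr : (centeredSum μ Y ω ^ (2 * K)).trace ≤ ε ^ (2 * K) := le_of_not_ge fun h => hω h
    have h1 := abs_dotProduct_mulVec_le_of_trace_pow_le (hZh ω) hK hε.le htr (N *ᵥ x)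
    have hZe : centeredSum μ Y ω = Vᵀ * ((∑ i, X i (ω i)) - S) * V := by
      rw [centeredSum, Finset.sum_sub_distrib, hYsum, Matrix.mul_sub, Matrix.sub_mul,
        Finset.mul_sum, Finset.sum_mul]
    have hNS : (N *ᵥ x) ⬝ᵥ (N *ᵥ x) = x ⬝ᵥ S *ᵥ x := by
      have := dotProduct_transpose_mul_mul_mulVec 1 N x
      rw [Matrix.mul_one, ← hN, one_mulVec] at this
      exact this.symm
    -- the kernel of `S` is contained in the kernel of every sample
    have hker : ∀ v : n → ℝ, S *ᵥ v = 0 → ((∑ i, X i (ω i)) - S) *ᵥ v = 0 := by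
      intro v hv
      rw [sub_mulVec, hv, sub_zero, sum_mulVec]
      refine Finset.sum_eq_zero fun i _ => ?_
      rw [← (hpos i (ω i)).dotProduct_mulVec_zero_iff]
      have a1 := (hpos i (ω i)).dotProduct_mulVec_nonneg v
      have a2 := (hle i (ω i)).dotProduct_mulVec_nonneg v
      rw [sub_mulVec, smul_mulVec, hv, smul_zero, zero_sub, dotProduct_neg] at a2
      linarith
    have hfac : ((∑ i, X i (ω i)) - S) * (V * N) = (∑ i, X i (ω i)) - S := by
      have h0 : ((∑ i, X i (ω i)) - S) * (1 - V * N) = 0 := by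
        refine Matrix.ext_of_mulVec_single fun j => ?_
        rw [← mulVec_mulVec, zero_mulVec]
        refine hker _ ?_
        rw [mulVec_mulVec, hVN, zero_mulVec]
      rw [Matrix.mul_sub, Matrix.mul_one, sub_eq_zero] at h0
      exact h0.symm
    have hsymm : ((∑ i, X i (ω i)) - S)ᵀ = (∑ i, X i (ω i)) - S := by
      have : ((∑ i, X i (ω i)) - S).IsHermitian :=
        IsHermitian.sub (isSelfAdjoint_sum _ fun i _ => (hpos i (ω i)).isHermitian) hS.isHermitian
      rw [← conjTranspose_eq_transpose_of_trivial]
      exact this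
    have hconj : (V * N)ᵀ * ((∑ i, X i (ω i)) - S) * (V * N) = (∑ i, X i (ω i)) - S := by
      rw [Matrix.mul_assoc, hfac, ← hsymm, ← transpose_mul, hfac]
    rw [hNS, hZe, dotProduct_transpose_mul_mul_mulVec, mulVec_mulVec,
      ← dotProduct_transpose_mul_mul_mulVec, hconj, sub_mulVec, dotProduct_sub] at h1
    exact h1
  calc _ ≤ 1 - (Measure.pi μ).real B := by linarith
    _ = (Measure.pi μ).real Bᶜ := (probReal_compl_eq_one_sub hBm).symm
    _ ≤ _ := measureReal_mono hsub

end Concentration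

/-! ### The law of the first hit of a random walk -/

section WalkLaw

theorem measurableSet_firstHit {α β : Type*} (G : Graph α β) [Fintype V(G)] (T : Set V(G)) (i : ℕ)
    (y : V(G)) :
    MeasurableSet {X : ℕ → V(G) | (∀ k < i, X k ∉ T) ∧ X i = y} := by
  have : {X : ℕ → V(G) | (∀ k < i, X k ∉ T) ∧ X i = y} =
      (⋂ k ∈ Finset.range i, (fun X => X k) ⁻¹' Tᶜ) ∩ (fun X => X i) ⁻¹' {y} := by
    ext X; simp
  rw [this]
  exact (Finset.measurableSet_biInter _ fun k _ =>
    measurable_pi_apply k MeasurableSet.of_discrete).inter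
    (measurable_pi_apply i (measurableSet_singleton y))

variable {α β : Type*} (G : Graph α β) [Fintype V(G)] [Fintype E(G)]

/-- The transition matrix of the random walk. -/
noncomputable def stepMatrix : Matrix V(G) V(G) ℝ := fun x y => (stepLaw G x y).toReal

open Classical in
/-- The transition matrix of the random walk killed as soon as it tries to leave `T`. Its rows in
`T` are zero, so the `(x, y)` entry of its `i`-th power is the probability that the walk from `x`
avoids `T` before time `i` and is at `y` at time `i`. -/
noncomputable def killedMatrix (T : Set V(G)) : Matrix V(G) V(G) ℝ :=
  fun x y => if x ∈ T then 0 else stepMatrix G x y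

theorem stepMatrix_nonneg (x y : V(G)) : 0 ≤ stepMatrix G x y := ENNReal.toReal_nonneg

theorem killedMatrix_nonneg (T : Set V(G)) (x y : V(G)) : 0 ≤ killedMatrix G T x y := by
  unfold killedMatrix
  split_ifs
  · exact le_rfl
  · exact stepMatrix_nonneg G x y

open Classical in
theorem killedMatrix_pow_nonneg (T : Set V(G)) (i : ℕ) (x y : V(G)) :
    0 ≤ (killedMatrix G T ^ i) x y := by
  induction i generalizing y with
  | zero => rw [pow_zero, Matrix.one_apply]; split_ifs <;> norm_num
  | succ i ih =>
    rw [pow_succ, Matrix.mul_apply]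
    exact Finset.sum_nonneg fun z _ => mul_nonneg (ih z) (killedMatrix_nonneg G T z y)

theorem degree_mul_stepMatrix (x y : V(G)) :
    (∑ z, adjMatrix G x z) * stepMatrix G x y = adjMatrix G x y := by
  by_cases h : ∃ y, edgeMult G x y ≠ 0
  · have hs : stepMatrix G x y = adjMatrix G x y * (∑ z, adjMatrix G x z)⁻¹ := by
      unfold stepMatrix stepLaw adjMatrix
      rw [dif_pos h, PMF.normalize_apply, tsum_fintype, ENNReal.toReal_mul, ENNReal.toReal_inv,
        ENNReal.toReal_sum fun _ _ => ENNReal.natCast_ne_top _]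
      simp
    have hne : (∑ z, adjMatrix G x z) ≠ 0 := by
      obtain ⟨w, hw⟩ := h
      have : 0 < adjMatrix G x w := by
        unfold adjMatrix
        exact_mod_cast Nat.pos_of_ne_zero hw
      exact (lt_of_lt_of_le this (Finset.single_le_sum (f := fun z => adjMatrix G x z)
        (fun z _ => Nat.cast_nonneg _) (Finset.mem_univ w))).ne'
    rw [hs]
    field_simp
  · push Not at h
    simp [adjMatrix, h]

/-- The Markov property at time `i`, for events that fix the position at that time. -/
theorem walkLaw_inter_succ (u z y : V(G)) (T : Set V(G)) (i : ℕ) :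
    walkLaw G u {X | ((∀ k < i, X k ∉ T) ∧ X i = z) ∧ X (i + 1) = y} =
      walkLaw G u {X | (∀ k < i, X k ∉ T) ∧ X i = z} * stepLaw G z y := by
  have hmap := Kernel.partialTraj_compProd_eq_map_traj (X := fun _ => V(G)) (κ := stepKernel G)
    (Nat.zero_le i) (x₀ := fun _ => u)
  have hmap' := Kernel.traj_map_frestrictLe_apply (X := fun _ => V(G)) (κ := stepKernel G) 0 i
    (fun _ => u)
  set A : Set (∀ _ : Finset.Iic i, V(G)) :=
    {h | (∀ k : Finset.Iic i, (k : ℕ) < i → h k ∉ T) ∧ h ⟨i, Finset.mem_Iic.mpr le_rfl⟩ = z} with hA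
  have hAm : MeasurableSet A := (Set.to_countable A).measurableSet
  have e1 : {X : ℕ → V(G) | (∀ k < i, X k ∉ T) ∧ X i = z} =
      Preorder.frestrictLe (π := fun _ => V(G)) i ⁻¹' A := by
    ext X
    simp only [Set.mem_ofPred_eq, hA, Set.mem_preimage, Preorder.frestrictLe_apply]
    exact and_congr_left fun _ => ⟨fun h k hk => h k hk, fun h k hk =>
      h ⟨k, Finset.mem_Iic.mpr hk.le⟩ hk⟩
  have e2 : {X : ℕ → V(G) | ((∀ k < i, X k ∉ T) ∧ X i = z) ∧ X (i + 1) = y} =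
      (fun X => (Preorder.frestrictLe (π := fun _ => V(G)) i X, X (i + 1))) ⁻¹' (A ×ˢ {y}) := by
    ext X
    have : X ∈ {X : ℕ → V(G) | (∀ k < i, X k ∉ T) ∧ X i = z} ↔
      X ∈ Preorder.frestrictLe (π := fun _ => V(G)) i ⁻¹' A := by rw [e1]
    exact and_congr_left fun _ => this
  have hm1 : Measurable (Preorder.frestrictLe (π := fun _ => V(G)) i) :=
    Preorder.measurable_frestrictLe i
  rw [e2, e1, walkLaw, ← Measure.map_apply (hm1.prodMk (measurable_pi_apply _))
    (hAm.prod (measurableSet_singleton y)), ← hmap, ← Measure.map_apply hm1 hAm, hmap',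
    Measure.compProd_apply_prod hAm (measurableSet_singleton y)]
  rw [setLIntegral_congr_fun (g := fun _ => stepLaw G z y) hAm, setLIntegral_const, mul_comm]
  intro h hh
  change (stepLaw G (h ⟨i, _⟩)).toMeasure {y} = _
  rw [hh.2, PMF.toMeasure_apply_singleton _ _ (measurableSet_singleton y)]

open Classical in
/-- The powers of the killed transition matrix give the law of the first hit, by induction on the
time and summation over the last position before it. -/
theorem walkLaw_firstHit (u y : V(G)) (T : Set V(G)) (i : ℕ) :
    (walkLaw G u).real {X | (∀ k < i, X k ∉ T) ∧ X i = y} = (killedMatrix G T ^ i) u y := by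
  induction i generalizing y with
  | zero =>
    have h := Kernel.traj_map_frestrictLe_apply (X := fun _ => V(G)) (κ := stepKernel G) 0 0
      (fun _ => u)
    rw [Kernel.partialTraj_self, Kernel.id_apply] at h
    have hm1 : Measurable (Preorder.frestrictLe (π := fun _ => V(G)) 0) :=
      Preorder.measurable_frestrictLe 0
    have e : {X : ℕ → V(G) | (∀ k < 0, X k ∉ T) ∧ X 0 = y} =
        Preorder.frestrictLe (π := fun _ => V(G)) 0 ⁻¹'
          {h | h ⟨0, Finset.mem_Iic.mpr le_rfl⟩ = y} := by
      ext X; simp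
    rw [e, walkLaw, measureReal_def, ← Measure.map_apply hm1 (Set.to_countable _).measurableSet, h,
      Measure.dirac_apply' _ (Set.to_countable _).measurableSet, pow_zero, Matrix.one_apply]
    by_cases huy : u = y <;> simp [huy]
  | succ i ih =>
    have h1 : walkLaw G u {X | (∀ k < i + 1, X k ∉ T) ∧ X (i + 1) = y} =
        ∑ z, walkLaw G u ({X | (∀ k < i + 1, X k ∉ T) ∧ X (i + 1) = y} ∩ {X | X i = z}) := by
      have := sum_measure_preimage_singleton (μ := (walkLaw G u).restrict
        {X | (∀ k < i + 1, X k ∉ T) ∧ X (i + 1) = y}) (f := fun X : ℕ → V(G) => X i) Finset.univ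
        (fun z _ => measurable_pi_apply i (measurableSet_singleton z))
      simp only [Finset.coe_univ, Set.preimage_univ, Measure.restrict_apply_univ] at this
      rw [← this]
      refine Finset.sum_congr rfl fun z _ => ?_
      rw [Measure.restrict_apply (measurable_pi_apply i (measurableSet_singleton z)),
        Set.inter_comm]
      rfl
    rw [measureReal_def, h1, ENNReal.toReal_sum fun _ _ => measure_ne_top _ _, pow_succ,
      Matrix.mul_apply]
    refine Finset.sum_congr rfl fun z _ => ?_
    by_cases hz : z ∈ T
    · have : {X : ℕ → V(G) | (∀ k < i + 1, X k ∉ T) ∧ X (i + 1) = y} ∩ {X | X i = z} = ∅ := by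
        ext X
        simp only [Set.mem_inter_iff, Set.mem_ofPred_eq, Set.mem_empty_iff_false, iff_false]
        rintro ⟨⟨h, -⟩, rfl⟩
        exact h i (Nat.lt_succ_self i) hz
      rw [this]
      simp [killedMatrix, hz]
    · have : {X : ℕ → V(G) | (∀ k < i + 1, X k ∉ T) ∧ X (i + 1) = y} ∩ {X | X i = z} =
          {X | ((∀ k < i, X k ∉ T) ∧ X i = z) ∧ X (i + 1) = y} := by
        ext X
        simp only [Set.mem_inter_iff, Set.mem_ofPred_eq]
        constructor
        · rintro ⟨⟨h, h'⟩, h''⟩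
          exact ⟨⟨fun k hk => h k (hk.trans (Nat.lt_succ_self i)), h''⟩, h'⟩
        · rintro ⟨⟨h, h''⟩, h'⟩
          refine ⟨⟨fun k hk => ?_, h'⟩, h''⟩
          rcases Nat.lt_succ_iff_lt_or_eq.mp hk with hk | rfl
          · exact h k hk
          · rwa [h'']
      rw [this, walkLaw_inter_succ, ENNReal.toReal_mul, ← measureReal_def, ih]
      simp [killedMatrix, hz, stepMatrix]

end WalkLaw

section Outcome

variable {S : Type*} {T : Set S}

open Classical in
/-- The time and place of the first hit of `T`, if there is one. -/
noncomputable def outcome (T : Set S) (X : ℕ → S) : Option (ℕ × T) :=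
  if h : Hits T X then some (hitTime h, hitPoint h) else none

theorem outcome_eq_some_iff {X : ℕ → S} {i : ℕ} {s : T} :
    outcome T X = some (i, s) ↔ (∀ k < i, X k ∉ T) ∧ X i = s := by
  classical
  constructor
  · intro h
    unfold outcome at h
    split_ifs at h with hX
    simp only [Option.some.injEq, Prod.mk.injEq] at h
    obtain ⟨rfl, rfl⟩ := h
    exact ⟨fun k hk => Nat.find_min hX hk, rfl⟩
  · rintro ⟨h1, h2⟩
    have hX : Hits T X := ⟨i, h2 ▸ s.2⟩
    have hi : hitTime hX = i := (Nat.find_eq_iff hX).mpr ⟨h2 ▸ s.2, h1⟩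
    unfold outcome
    rw [dif_pos hX]
    simp only [Option.some.injEq, Prod.mk.injEq]
    refine ⟨hi, Subtype.ext ?_⟩
    simp only [hitPoint, hi, h2]

open Classical in
/-- The adjacency matrix of a sampled edge in terms of the two outcomes. -/
noncomputable def outcomeAdj (T : Set S) (ρ : ℕ) : Option (ℕ × T) → Option (ℕ × T) → Matrix T T ℝ
  | some (i, s), some (j, t) =>
    (1 / ((ρ : ℝ) * ((i + 1 + j : ℕ) : ℝ))) • (Matrix.single s t 1 + Matrix.single t s 1)
  | _, _ => 0

theorem sampleAdj_eq_outcomeAdj (ρ : ℕ) (X Y : ℕ → S) :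
    sampleAdj T ρ X Y = outcomeAdj T ρ (outcome T X) (outcome T Y) := by
  unfold sampleAdj outcome
  by_cases hX : Hits T X <;> by_cases hY : Hits T Y <;> simp [hX, hY, outcomeAdj]

end Outcome

section OutcomeLaw

variable {α β : Type*} (G : Graph α β) [Fintype V(G)] (T : Set V(G))

instance outcomeMeasurableSpace {S : Type*} (T : Set S) : MeasurableSpace (Option (ℕ × T)) := ⊤

instance outcomeDiscrete {S : Type*} (T : Set S) : DiscreteMeasurableSpace (Option (ℕ × T)) :=
  ⟨fun _ => trivial⟩

theorem measurable_outcome : Measurable (outcome T : (ℕ → V(G)) → Option (ℕ × T)) := by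
  have hsome : ∀ p : ℕ × T, MeasurableSet (outcome T ⁻¹' {some p} : Set (ℕ → V(G))) := by
    rintro ⟨i, s⟩
    have : (outcome T ⁻¹' {some (i, s)} : Set (ℕ → V(G))) =
        {X | (∀ k < i, X k ∉ T) ∧ X i = (s : V(G))} := by
      ext X; exact outcome_eq_some_iff
    rw [this]
    exact measurableSet_firstHit G T i s
  refine measurable_to_countable' fun o => ?_
  rcases o with _ | p
  · have : (outcome T ⁻¹' {none} : Set (ℕ → V(G))) = (⋃ p, outcome T ⁻¹' {some p})ᶜ := by
      ext X
      simp [Option.eq_none_iff_forall_ne_some]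
    rw [this]
    exact (MeasurableSet.iUnion hsome).compl
  · exact hsome p

variable [Fintype E(G)]

/-- The law of the time and place of the first hit of `T` by a walk from `u`. -/
noncomputable def outcomeLaw (u : V(G)) : Measure (Option (ℕ × T)) :=
  (walkLaw G u).map (outcome T)

instance outcomeLaw_prob (u : V(G)) : IsProbabilityMeasure (outcomeLaw G T u) :=
  Measure.isProbabilityMeasure_map (measurable_outcome G T).aemeasurable

open Classical in
theorem outcomeLaw_singleton (u : V(G)) (i : ℕ) (s : T) :
    (outcomeLaw G T u).real {some (i, s)} = (killedMatrix G T ^ i) u s := by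
  rw [← walkLaw_firstHit, outcomeLaw, map_measureReal_apply (measurable_outcome G T)
    (measurableSet_singleton _)]
  congr 1
  ext X
  exact outcome_eq_some_iff

end OutcomeLaw

/-! ### Laplacians and Schur complements -/

section LaplacianForm

open Matrix

variable {n : Type*} [Fintype n]

theorem lap_apply [DecidableEq n] (B : Matrix n n ℝ) (s t : n) :
    lap B s t = (if s = t then ∑ y, B s y else 0) - B s t := by
  by_cases h : s = t
  · subst h; simp [lap]
  · simp [lap, h]

theorem lap_sum {ι : Type*} (s : Finset ι) (B : ι → Matrix n n ℝ) :
    lap (∑ i ∈ s, B i) = ∑ i ∈ s, lap (B i) := by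
  classical
  ext a b
  simp only [lap_apply, Matrix.sum_apply, Finset.sum_sub_distrib]
  split_ifs
  · rw [Finset.sum_comm]
  · simp

theorem lap_transpose {B : Matrix n n ℝ} (hB : Bᵀ = B) : (lap B)ᵀ = lap B := by
  classical
  rw [lap, transpose_sub, diagonal_transpose, hB]

theorem lap_mulVec_one (B : Matrix n n ℝ) : lap B *ᵥ 1 = 0 := by
  classical
  ext s
  simp [mulVec, dotProduct, lap_apply]

theorem two_mul_dotProduct_lap_mulVec {B : Matrix n n ℝ} (hB : Bᵀ = B) (x : n → ℝ) :
    2 * (x ⬝ᵥ lap B *ᵥ x) = ∑ s, ∑ t, B s t * (x s - x t) ^ 2 := by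
  classical
  have h1 : x ⬝ᵥ lap B *ᵥ x = ∑ s, ∑ t, (B s t * x s ^ 2 - B s t * (x s * x t)) := by
    simp only [dotProduct, mulVec, lap_apply, sub_mul, Finset.sum_sub_distrib, ite_mul, zero_mul,
      Finset.sum_ite_eq, Finset.mem_univ, if_true, mul_sub, Finset.mul_sum, Finset.sum_mul]
    congr 1 <;>
    · refine Finset.sum_congr rfl fun s _ => Finset.sum_congr rfl fun t _ => ?_
      ring
  have h2 : ∑ s, ∑ t, B s t * x t ^ 2 = ∑ s, ∑ t, B s t * x s ^ 2 := by
    rw [Finset.sum_comm]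
    refine Finset.sum_congr rfl fun s _ => Finset.sum_congr rfl fun t _ => ?_
    rw [← hB, transpose_apply, hB]
  have h3 : ∑ s, ∑ t, B s t * (x s - x t) ^ 2 = ∑ s, ∑ t, B s t * x s ^ 2 +
      ∑ s, ∑ t, B s t * x t ^ 2 - 2 * ∑ s, ∑ t, B s t * (x s * x t) := by
    simp only [Finset.mul_sum, ← Finset.sum_add_distrib, ← Finset.sum_sub_distrib]
    refine Finset.sum_congr rfl fun s _ => Finset.sum_congr rfl fun t _ => ?_
    ring
  rw [h3, h2, h1]
  simp only [Finset.sum_sub_distrib]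
  ring

theorem posSemidef_lap {B : Matrix n n ℝ} (hB : Bᵀ = B) (h0 : ∀ s t, 0 ≤ B s t) :
    (lap B).PosSemidef := by
  refine .of_dotProduct_mulVec_nonneg ?_ fun x => ?_
  · rw [IsHermitian, conjTranspose_eq_transpose_of_trivial, lap_transpose hB]
  · have h := two_mul_dotProduct_lap_mulVec hB x
    have : 0 ≤ ∑ s, ∑ t, B s t * (x s - x t) ^ 2 :=
      Finset.sum_nonneg fun s _ => Finset.sum_nonneg fun t _ => mul_nonneg (h0 s t) (sq_nonneg _)
    rw [star_trivial]
    linarith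

end LaplacianForm

section Schur

open Matrix

variable {n : Type*} [Fintype n] [DecidableEq n] {L : Matrix n n ℝ} {T : Set n} {H : Matrix n T ℝ}

open Classical in
/-- A matrix `H` whose columns extend the unit vectors on `T` harmonically off `T` computes the
Schur complement. The pseudo-inverse enters only through the first Penrose equation, since `H`
factors the off-diagonal block of `L` through the block being inverted; that block may be
singular. -/
theorem schurOnto_eq_of_harmonic (hL : Lᵀ = L)
    (hT : ∀ s t : T, H s t = if s = t then 1 else 0) (hF : ∀ x ∉ T, ∀ t, (L * H) x t = 0) :
    schurOnto L T = (L * H).submatrix (fun s : T => (s : n)) id ∧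
      (L *ᵥ 1 = 0 → schurOnto L T *ᵥ 1 = 0) := by
  set LTT := L.submatrix (fun x : T => (x : n)) (fun y : T => (y : n)) with hLTT
  set LTF := L.submatrix (fun x : T => (x : n)) (fun y : (Tᶜ : Set n) => (y : n)) with hLTF
  set LFF := L.submatrix (fun x : (Tᶜ : Set n) => (x : n)) (fun y : (Tᶜ : Set n) => (y : n))
    with hLFF
  set LFT := L.submatrix (fun x : (Tᶜ : Set n) => (x : n)) (fun y : T => (y : n)) with hLFT
  set HF := H.submatrix (fun x : (Tᶜ : Set n) => (x : n)) id with hHF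
  have split : ∀ f : n → ℝ, ∑ y, f y = ∑ y : T, f y + ∑ y : (Tᶜ : Set n), f y := by
    intro f
    rw [← Fintype.sum_subtype_add_sum_subtype (fun y => y ∈ T) f]
    congr
  have hLH : ∀ x t, (L * H) x t = L x t + ∑ y : (Tᶜ : Set n), L x y * H y t := by
    intro x t
    rw [Matrix.mul_apply, split]
    simp [hT]
  have e1 : LFT = -(LFF * HF) := by
    ext x t
    have := hF x x.2 t
    rw [hLH] at this
    exact eq_neg_of_add_eq_zero_left this
  have e2 : LTF = -(HFᵀ * LFF) := by
    have h1 : LTF = LFTᵀ := by rw [hLTF, hLFT, transpose_submatrix, hL]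
    have h2 : LFFᵀ = LFF := by rw [hLFF, transpose_submatrix, hL]
    rw [h1, e1, transpose_neg, transpose_mul, h2]
  have e3 : schurOnto L T = LTT + LTF * HF := by
    calc schurOnto L T = LTT - LTF * pinv LFF * LFT := rfl
      _ = LTT - HFᵀ * (LFF * pinv LFF * LFF) * HF := by
          rw [e1, e2]
          simp only [Matrix.neg_mul, Matrix.mul_neg, neg_neg, Matrix.mul_assoc]
      _ = _ := by rw [(pinv_spec LFF).mul_mul, e2, Matrix.neg_mul, sub_eq_add_neg]
  refine ⟨?_, fun h1 => ?_⟩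
  · rw [e3]
    ext s t
    exact (hLH s t).symm
  · have r1 : LTT *ᵥ 1 + LTF *ᵥ 1 = 0 := by
      ext s
      have := congrFun h1 s
      simp only [mulVec, dotProduct, split] at this
      exact this
    have r2 : LFT *ᵥ 1 + LFF *ᵥ 1 = 0 := by
      ext s
      have := congrFun h1 s
      simp only [mulVec, dotProduct, split] at this
      exact this
    have r3 : (LTF * HF) *ᵥ 1 = LTF *ᵥ 1 := by
      calc (LTF * HF) *ᵥ 1 = HFᵀ *ᵥ (LFT *ᵥ 1) := by
            rw [e1, e2, mulVec_mulVec]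
            simp only [Matrix.neg_mul, Matrix.mul_neg, Matrix.mul_assoc]
        _ = HFᵀ *ᵥ (-(LFF *ᵥ 1)) := by rw [eq_neg_of_add_eq_zero_left r2]
        _ = LTF *ᵥ 1 := by rw [e2, mulVec_neg, mulVec_mulVec, neg_mulVec]
    rw [e3, add_mulVec, r3, r1]

open Classical in
theorem dotProduct_schurOnto_mulVec (hL : Lᵀ = L)
    (hT : ∀ s t : T, H s t = if s = t then 1 else 0) (hF : ∀ x ∉ T, ∀ t, (L * H) x t = 0)
    (x : T → ℝ) :
    x ⬝ᵥ schurOnto L T *ᵥ x = (H *ᵥ x) ⬝ᵥ L *ᵥ (H *ᵥ x) := by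
  have hHx : ∀ s : T, (H *ᵥ x) s = x s := by
    intro s
    simp [mulVec, dotProduct, hT]
  have hLH : ∀ y ∉ T, (L *ᵥ (H *ᵥ x)) y = 0 := by
    intro y hy
    rw [mulVec_mulVec]
    simp [mulVec, dotProduct, hF y hy]
  rw [(schurOnto_eq_of_harmonic hL hT hF).1]
  simp only [dotProduct]
  rw [← Fintype.sum_subtype_add_sum_subtype (fun y => y ∈ T)
    (fun y => (H *ᵥ x) y * (L *ᵥ (H *ᵥ x)) y)]
  have h0 : ∑ y : {y // y ∉ T}, (H *ᵥ x) y * (L *ᵥ (H *ᵥ x)) y = 0 :=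
    Finset.sum_eq_zero fun y _ => by rw [hLH y y.2, mul_zero]
  rw [h0, add_zero]
  refine Finset.sum_congr rfl fun s _ => ?_
  rw [hHx, mulVec_mulVec]
  rfl

end Schur

section HittingMatrix

open Matrix

variable {α β : Type*} (G : Graph α β)

open Classical in
theorem edgeMult_comm [Fintype E(G)] (x y : V(G)) : edgeMult G x y = edgeMult G y x := by
  unfold edgeMult
  simp only [eq_comm (a := x), Graph.isLink_comm (x := (x : α))]

theorem adjMatrix_transpose [Fintype E(G)] : (adjMatrix G)ᵀ = adjMatrix G := by
  ext x y
  rw [transpose_apply, adjMatrix, adjMatrix, edgeMult_comm]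

variable [Fintype V(G)] [Fintype E(G)] (T : Set V(G))

open Classical in
theorem adjMatrix_mul_killedMatrix_transpose :
    (adjMatrix G * killedMatrix G T)ᵀ = adjMatrix G * killedMatrix G T := by
  have h : ∀ x y, (adjMatrix G * killedMatrix G T) x y =
      ∑ z, if z ∈ T then 0 else
        (∑ w, adjMatrix G z w) * (stepMatrix G z x * stepMatrix G z y) := by
    intro x y
    rw [Matrix.mul_apply]
    refine Finset.sum_congr rfl fun z _ => ?_
    rw [killedMatrix]
    split_ifs
    · rw [mul_zero]
    · rw [← adjMatrix_transpose, transpose_apply, ← degree_mul_stepMatrix G z x, mul_assoc]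
      simp only [adjMatrix_transpose]
  ext x y
  rw [transpose_apply, h, h]
  simp only [mul_comm]

open Classical in
/-- Reversibility of the killed walk. -/
theorem killedMatrix_transpose_pow_mul_adjMatrix (i : ℕ) :
    ((killedMatrix G T) ^ i)ᵀ * adjMatrix G = adjMatrix G * killedMatrix G T ^ i := by
  induction i with
  | zero => simp
  | succ i ih =>
    have h : (killedMatrix G T)ᵀ * adjMatrix G = adjMatrix G * killedMatrix G T := by
      have := adjMatrix_mul_killedMatrix_transpose G T
      rwa [transpose_mul, adjMatrix_transpose] at this
    rw [pow_succ, transpose_mul, Matrix.mul_assoc, ih, ← Matrix.mul_assoc, h, Matrix.mul_assoc,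
      ← pow_succ', pow_succ]

open Classical in
theorem adjMatrix_mul_killedMatrix_pow_transpose (i : ℕ) :
    (adjMatrix G * killedMatrix G T ^ i)ᵀ = adjMatrix G * killedMatrix G T ^ i := by
  rw [transpose_mul, adjMatrix_transpose, killedMatrix_transpose_pow_mul_adjMatrix]

open Classical in
theorem summable_killedMatrix_pow (u : V(G)) (t : T) :
    Summable fun i => (killedMatrix G T ^ i) u t := by
  refine summable_of_sum_le (c := 1) (fun i => killedMatrix_pow_nonneg G T i u t) fun s => ?_
  have hinj : Set.InjOn (fun i : ℕ => (some (i, t) : Option (ℕ × T))) s := by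
    intro i _ j _ h
    simpa using h
  calc ∑ i ∈ s, (killedMatrix G T ^ i) u t
      = ∑ o ∈ s.image (fun i : ℕ => (some (i, t) : Option (ℕ × T))),
          (outcomeLaw G T u).real {o} := by
        rw [Finset.sum_image hinj]
        simp only [outcomeLaw_singleton]
    _ = (outcomeLaw G T u).real (s.image (fun i : ℕ => (some (i, t) : Option (ℕ × T)))) :=
        sum_measureReal_singleton _
    _ ≤ 1 := measureReal_le_one

open Classical in
/-- The probability that the walk from `x` first hits `T` at `t`. -/
noncomputable def hittingMatrix : Matrix V(G) T ℝ := fun x t => ∑' i, (killedMatrix G T ^ i) x t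

open Classical in
theorem hittingMatrix_eq (x : V(G)) (t : T) :
    hittingMatrix G T x t =
      (if x = t then 1 else 0) + ∑ z, killedMatrix G T x z * hittingMatrix G T z t := by
  rw [hittingMatrix, (summable_killedMatrix_pow G T x t).tsum_eq_zero_add, pow_zero,
    Matrix.one_apply]
  congr 1
  simp only [pow_succ', Matrix.mul_apply]
  rw [Summable.tsum_finsetSum fun z _ => (summable_killedMatrix_pow G T z t).mul_left _]
  refine Finset.sum_congr rfl fun z _ => ?_
  rw [tsum_mul_left, hittingMatrix]

open Classical in
theorem hittingMatrix_of_mem (s t : T) : hittingMatrix G T s t = if s = t then 1 else 0 := by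
  rw [hittingMatrix_eq]
  simp [killedMatrix, Subtype.ext_iff]

theorem lap_mul_apply {n m : Type*} [Fintype n] (A : Matrix n n ℝ) (H : Matrix n m ℝ) (x : n)
    (t : m) : (lap A * H) x t = (∑ z, A x z) * H x t - (A * H) x t := by
  classical
  rw [lap, Matrix.sub_mul, Matrix.sub_apply, Matrix.diagonal_mul]

theorem lap_mul_hittingMatrix_of_notMem (x : V(G)) (hx : x ∉ T) (t : T) :
    (lap (adjMatrix G) * hittingMatrix G T) x t = 0 := by
  classical
  have hxt : x ≠ t := fun h => hx (h ▸ t.2)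
  rw [lap_mul_apply, hittingMatrix_eq, if_neg hxt, zero_add, Finset.mul_sum, Matrix.mul_apply,
    sub_eq_zero]
  refine Finset.sum_congr rfl fun z _ => ?_
  rw [killedMatrix, if_neg hx, ← mul_assoc, degree_mul_stepMatrix]

/-- The total weight of the walks of length at least one between two vertices of `T` that avoid `T`
in between, where a walk has the product of the adjacency matrix entries along its edges, divided by
the degrees of its inner vertices, as its weight. -/
noncomputable def excursionMatrix : Matrix T T ℝ :=
  (adjMatrix G * hittingMatrix G T).submatrix (fun s : T => (s : V(G))) id

open Classical in
theorem hasSum_excursionMatrix (s t : T) :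
    HasSum (fun l => (adjMatrix G * killedMatrix G T ^ l) s t) (excursionMatrix G T s t) := by
  simp only [Matrix.mul_apply, excursionMatrix, Matrix.submatrix_apply, id]
  exact hasSum_sum fun z _ => (summable_killedMatrix_pow G T z t).hasSum.mul_left _

theorem excursionMatrix_transpose : (excursionMatrix G T)ᵀ = excursionMatrix G T := by
  classical
  ext s t
  rw [transpose_apply]
  refine (hasSum_excursionMatrix G T t s).unique ?_
  convert hasSum_excursionMatrix G T s t using 2 with l
  exact congrFun (congrFun (adjMatrix_mul_killedMatrix_pow_transpose G T l) s) t

theorem excursionMatrix_nonneg (s t : T) : 0 ≤ excursionMatrix G T s t := by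
  classical
  refine (hasSum_excursionMatrix G T s t).nonneg fun l => ?_
  rw [Matrix.mul_apply]
  exact Finset.sum_nonneg fun z _ =>
    mul_nonneg (Nat.cast_nonneg _) (killedMatrix_pow_nonneg G T l z t)

open Classical in
/-- The Schur complement of the Laplacian is the Laplacian of the graph of excursions. -/
theorem SC_eq_lap_excursionMatrix : SC G T = lap (excursionMatrix G T) := by
  have h := schurOnto_eq_of_harmonic (lap_transpose (adjMatrix_transpose G))
    (hittingMatrix_of_mem G T) (lap_mul_hittingMatrix_of_notMem G T)
  have hrow := h.2 (lap_mulVec_one _)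
  have hoff : ∀ s t : T, s ≠ t → SC G T s t = -excursionMatrix G T s t := by
    intro s t hst
    rw [SC, h.1, Matrix.submatrix_apply, id, lap_mul_apply, hittingMatrix_of_mem, if_neg hst,
      mul_zero, zero_sub]
    rfl
  ext s t
  rw [lap_apply]
  by_cases hst : s = t
  · subst hst
    have h1 : ∑ t, SC G T s t = 0 := by
      have := congrFun hrow s
      simpa [mulVec, dotProduct, SC] using this
    rw [← Finset.add_sum_erase _ _ (Finset.mem_univ s)] at h1
    rw [if_pos rfl, ← Finset.add_sum_erase _ _ (Finset.mem_univ s), add_sub_cancel_left]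
    rw [Finset.sum_congr rfl fun t ht => hoff s t (Finset.ne_of_mem_erase ht).symm,
      Finset.sum_neg_distrib] at h1
    linarith
  · rw [if_neg hst, zero_sub, hoff s t hst]

open Classical in
theorem dotProduct_SC_mulVec (x : T → ℝ) :
    x ⬝ᵥ SC G T *ᵥ x =
      (hittingMatrix G T *ᵥ x) ⬝ᵥ lap (adjMatrix G) *ᵥ (hittingMatrix G T *ᵥ x) :=
  dotProduct_schurOnto_mulVec (lap_transpose (adjMatrix_transpose G))
    (hittingMatrix_of_mem G T) (lap_mul_hittingMatrix_of_notMem G T) x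

end HittingMatrix

/-! ### Differences along walks are bounded by the energy -/

section Energy

/-- The squared difference of a function across an unordered pair. -/
def sqDiff {V : Type*} (f : V → ℝ) : Sym2 V → ℝ :=
  Sym2.lift ⟨fun x y => (f x - f y) ^ 2, fun x y => by ring⟩

theorem sqDiff_nonneg {V : Type*} (f : V → ℝ) (e : Sym2 V) : 0 ≤ sqDiff f e := by
  induction e with
  | h x y => exact sq_nonneg _

theorem sq_sub_le_length_mul_sum_sqDiff {V : Type*} {Γ : SimpleGraph V} (f : V → ℝ) {a b : V}
    (p : Γ.Walk a b) : (f a - f b) ^ 2 ≤ p.length * (p.edges.map (sqDiff f)).sum := by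
  induction p with
  | nil => simp
  | @cons a v b h p ih =>
    rw [SimpleGraph.Walk.length_cons, SimpleGraph.Walk.edges_cons, List.map_cons, List.sum_cons]
    have e : sqDiff f s(a, v) = (f a - f v) ^ 2 := rfl
    rw [e]
    set S := (p.edges.map (sqDiff f)).sum with hS
    have hSn : 0 ≤ S := List.sum_nonneg fun x hx => by
      obtain ⟨e, -, rfl⟩ := List.mem_map.mp hx
      exact sqDiff_nonneg f e
    set m : ℝ := (p.length : ℝ) with hm
    have hmn : 0 ≤ m := Nat.cast_nonneg _
    set d := f a - f v with hd
    set r := f v - f b with hr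
    have hdr : f a - f b = d + r := by rw [hd, hr]; ring
    have h1 : |r| ≤ √(m * S) := Real.abs_le_sqrt ih
    have h2 : 2 * (d * r) ≤ m * d ^ 2 + S := by
      have e1 : √(m * S) = √m * √S := Real.sqrt_mul hmn S
      have e2 := Real.sq_sqrt hmn
      have e3 := Real.sq_sqrt hSn
      have e4 : d * r ≤ |d| * (√m * √S) :=
        (le_abs_self _).trans (by
          rw [abs_mul, ← e1]; exact mul_le_mul_of_nonneg_left h1 (abs_nonneg d))
      have e5 := sq_nonneg (√m * |d| - √S)
      have e6 := sq_abs d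
      calc 2 * (d * r) ≤ 2 * (|d| * (√m * √S)) := by linarith
        _ ≤ (√m) ^ 2 * |d| ^ 2 + (√S) ^ 2 := by nlinarith
        _ = _ := by rw [e2, e3, e6]
    rw [hdr]
    push_cast
    nlinarith

variable {α β : Type*} (G : Graph α β) [Fintype E(G)]

/-- The simple graph underlying a multigraph. -/
def underlyingGraph : SimpleGraph V(G) where
  Adj x y := x ≠ y ∧ edgeMult G x y ≠ 0
  symm := ⟨fun x y h => ⟨h.1.symm, by rw [edgeMult_comm]; exact h.2⟩⟩
  loopless := ⟨fun _ h => h.1 rfl⟩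

theorem exists_walk_length_le_one {x y : V(G)} (h : edgeMult G x y ≠ 0) :
    ∃ p : (underlyingGraph G).Walk x y, p.length ≤ 1 := by
  by_cases hxy : x = y
  · subst hxy
    exact ⟨.nil, by simp⟩
  · have hadj : (underlyingGraph G).Adj x y := ⟨hxy, h⟩
    exact ⟨hadj.toWalk, by simp⟩

variable [Fintype V(G)]

theorem sum_sqDiff_le_energy (f : V(G) → ℝ) (F : Finset (Sym2 V(G)))
    (hF : ∀ e ∈ F, e ∈ (underlyingGraph G).edgeSet) :
    ∑ e ∈ F, sqDiff f e ≤ f ⬝ᵥ (lap (adjMatrix G)).mulVec f := by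
  classical
  have h1 := two_mul_dotProduct_lap_mulVec (adjMatrix_transpose G) f
  have h2 : 2 * ∑ e ∈ F, sqDiff f e ≤ ∑ s, ∑ t, adjMatrix G s t * (f s - f t) ^ 2 := by
    set pairs : Finset (V(G) × V(G)) := Finset.univ.filter fun p => s(p.1, p.2) ∈ F with hpairs
    calc 2 * ∑ e ∈ F, sqDiff f e
        ≤ ∑ e ∈ F, ∑ p ∈ pairs with s(p.1, p.2) = e, sqDiff f s(p.1, p.2) := by
          rw [Finset.mul_sum]
          refine Finset.sum_le_sum fun e he => ?_
          have hmem := hF e he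
          induction e with
          | h x y =>
          -- each edge is counted once for each of its two orientations
          have hxy : x ≠ y := (hmem : (underlyingGraph G).Adj x y).1
          have hsub : ({(x, y), (y, x)} : Finset (V(G) × V(G))) ⊆
              pairs.filter fun p => s(p.1, p.2) = s(x, y) := by
            intro p hp
            simp only [Finset.mem_insert, Finset.mem_singleton] at hp
            rcases hp with rfl | rfl
            · simp [hpairs, he]
            · have : s(y, x) = s(x, y) := Sym2.eq_swap
              simp [hpairs, this, he]
          refine le_trans (le_of_eq ?_) (Finset.sum_le_sum_of_subset_of_nonneg hsub
            fun p _ _ => sqDiff_nonneg f _)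
          rw [Finset.sum_pair (by simp [hxy])]
          have : s(y, x) = s(x, y) := Sym2.eq_swap
          simp only [this]
          ring
      _ = ∑ p ∈ pairs, sqDiff f s(p.1, p.2) :=
          Finset.sum_fiberwise_of_maps_to (fun p hp => (Finset.mem_filter.mp hp).2) _
      _ ≤ ∑ p ∈ pairs, adjMatrix G p.1 p.2 * (f p.1 - f p.2) ^ 2 := by
          refine Finset.sum_le_sum fun p hp => ?_
          have hadj := hF _ (Finset.mem_filter.mp hp).2
          have h : (1 : ℝ) ≤ adjMatrix G p.1 p.2 := by
            unfold adjMatrix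
            exact_mod_cast Nat.one_le_iff_ne_zero.mpr
              (hadj : (underlyingGraph G).Adj p.1 p.2).2
          exact le_mul_of_one_le_left (sq_nonneg _) h
      _ ≤ ∑ p : V(G) × V(G), adjMatrix G p.1 p.2 * (f p.1 - f p.2) ^ 2 := by
          refine Finset.sum_le_sum_of_subset_of_nonneg (Finset.filter_subset _ _) ?_
          intro p _ _
          have h : 0 ≤ adjMatrix G p.1 p.2 := by unfold adjMatrix; exact Nat.cast_nonneg _
          exact mul_nonneg h (sq_nonneg _)
      _ = _ := by rw [Fintype.sum_prod_type]
  linarith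

/-- The effective resistance between two vertices is at most their distance. Since the walk may
repeat edges, it is first shortcut to a path. -/
theorem sq_sub_le_length_mul_energy (f : V(G) → ℝ) {a b : V(G)}
    (p : (underlyingGraph G).Walk a b) :
    (f a - f b) ^ 2 ≤ p.length * (f ⬝ᵥ (lap (adjMatrix G)).mulVec f) := by
  classical
  have hpath := p.bypass_isPath
  have h1 := sq_sub_le_length_mul_sum_sqDiff f p.bypass
  have h2 : (p.bypass.edges.map (sqDiff f)).sum = ∑ e ∈ p.bypass.edges.toFinset, sqDiff f e :=
    (List.sum_toFinset (sqDiff f) hpath.isTrail.edges_nodup).symm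
  have h3 := sum_sqDiff_le_energy G f p.bypass.edges.toFinset fun e he =>
    p.bypass.edges_subset_edgeSet (List.mem_toFinset.mp he)
  have h0 : 0 ≤ ∑ e ∈ p.bypass.edges.toFinset, sqDiff f e :=
    Finset.sum_nonneg fun e _ => sqDiff_nonneg f e
  have h4 : (p.bypass.length : ℝ) ≤ p.length := by exact_mod_cast p.length_bypass_le_length
  rw [h2] at h1
  exact h1.trans (mul_le_mul h4 h3 h0 (Nat.cast_nonneg _))

theorem exists_walk_of_killedMatrix_ne_zero (T : Set V(G)) {x y : V(G)}
    (h : killedMatrix G T x y ≠ 0) : ∃ p : (underlyingGraph G).Walk x y, p.length ≤ 1 := by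
  by_cases hx : ∃ z, edgeMult G x z ≠ 0
  · refine exists_walk_length_le_one G fun h0 => h ?_
    have h1 := degree_mul_stepMatrix G x y
    rw [show adjMatrix G x y = 0 by simp [adjMatrix, h0], mul_eq_zero] at h1
    rcases h1 with h1 | h1
    · obtain ⟨z, hz⟩ := hx
      have := (Finset.sum_eq_zero_iff_of_nonneg fun z _ => Nat.cast_nonneg _).mp h1 z
        (Finset.mem_univ z)
      exact absurd (by exact_mod_cast this) hz
    · simp [killedMatrix, h1]
  · have : x = y := by
      by_contra hxy
      refine h ?_
      simp [killedMatrix, stepMatrix, stepLaw, hx, PMF.pure_apply, Ne.symm hxy]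
    subst this
    exact ⟨.nil, by simp⟩

open Classical in
theorem exists_walk_of_killedMatrix_pow_ne_zero (T : Set V(G)) {i : ℕ} {x y : V(G)}
    (h : (killedMatrix G T ^ i) x y ≠ 0) :
    ∃ p : (underlyingGraph G).Walk x y, p.length ≤ i := by
  induction i generalizing x with
  | zero =>
    rw [pow_zero, Matrix.one_apply] at h
    have : x = y := by by_contra hxy; simp [hxy] at h
    subst this
    exact ⟨.nil, by simp⟩
  | succ i ih =>
    rw [pow_succ', Matrix.mul_apply] at h
    obtain ⟨z, -, hz⟩ := Finset.exists_ne_zero_of_sum_ne_zero h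
    obtain ⟨p, hp⟩ := exists_walk_of_killedMatrix_ne_zero G T (left_ne_zero_of_mul hz)
    obtain ⟨q, hq⟩ := ih (right_ne_zero_of_mul hz)
    exact ⟨p.append q, by rw [SimpleGraph.Walk.length_append]; omega⟩

open Classical in
/-- A combined walk through an edge bounds the squared difference of its two ends by its length
times the energy of the harmonic extension. -/
theorem sq_sub_le_of_killedMatrix_pow_ne_zero {T : Set V(G)} {u v : V(G)}
    (huv : edgeMult G u v ≠ 0) {i j : ℕ} {s t : T} (hi : (killedMatrix G T ^ i) u s ≠ 0)
    (hj : (killedMatrix G T ^ j) v t ≠ 0) (x : T → ℝ) :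
    (x s - x t) ^ 2 ≤ ((i + 1 + j : ℕ) : ℝ) * (x ⬝ᵥ (SC G T).mulVec x) := by
  obtain ⟨p, hp⟩ := exists_walk_of_killedMatrix_pow_ne_zero G T hi
  obtain ⟨q, hq⟩ := exists_walk_of_killedMatrix_pow_ne_zero G T hj
  obtain ⟨r, hr⟩ := exists_walk_length_le_one G huv
  have h := sq_sub_le_length_mul_energy G ((hittingMatrix G T).mulVec x)
    (p.reverse.append (r.append q))
  have hHx : ∀ s : T, ((hittingMatrix G T).mulVec x) s = x s := by
    intro s
    simp [Matrix.mulVec, dotProduct, hittingMatrix_of_mem]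
  rw [hHx, hHx, ← dotProduct_SC_mulVec] at h
  have h0 : 0 ≤ x ⬝ᵥ (SC G T).mulVec x := by
    have := (posSemidef_lap (excursionMatrix_transpose G T)
      (excursionMatrix_nonneg G T)).dotProduct_mulVec_nonneg x
    rwa [← SC_eq_lap_excursionMatrix, star_trivial] at this
  refine h.trans (mul_le_mul_of_nonneg_right ?_ h0)
  rw [SimpleGraph.Walk.length_append, SimpleGraph.Walk.length_append,
    SimpleGraph.Walk.length_reverse]
  exact_mod_cast (by omega : p.length + (r.length + q.length) ≤ i + 1 + j)

end Energy

/-! ### The expectation of the sampled graph -/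

section Endpoints

variable {α β : Type*} (G : Graph α β) {ends : E(G) → V(G) × V(G)}

theorem isLink_iff_ends (hends : ∀ e : E(G), G.IsLink e (ends e).1 (ends e).2) (e : E(G))
    (x y : V(G)) : G.IsLink e x y ↔ ends e = (x, y) ∨ ends e = (y, x) := by
  constructor
  · intro h
    rcases (hends e).eq_and_eq_or_eq_and_eq h with ⟨h1, h2⟩ | ⟨h1, h2⟩
    · exact .inl (Prod.ext (Subtype.ext h1) (Subtype.ext h2))
    · exact .inr (Prod.ext (Subtype.ext h1) (Subtype.ext h2))
  · rintro (h | h)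
    · have := hends e; rwa [h] at this
    · have := hends e; rw [h] at this; exact this.symm

variable [Fintype E(G)]

theorem edgeMult_ne_zero_of_isLink {e : E(G)} {x y : V(G)} (h : G.IsLink e x y) :
    edgeMult G x y ≠ 0 := by
  classical
  unfold edgeMult
  have : Nonempty {e : E(G) // G.IsLink e x y} := ⟨⟨e, h⟩⟩
  exact mul_ne_zero (by split_ifs <;> norm_num) Fintype.card_ne_zero

open Classical in
/-- Each edge contributes its two orientations to the adjacency matrix; for a loop these coincide,
which is why a loop counts twice. -/
theorem adjMatrix_eq_sum_ends (hends : ∀ e : E(G), G.IsLink e (ends e).1 (ends e).2)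
    (x y : V(G)) :
    adjMatrix G x y =
      ∑ e, ((if ends e = (x, y) then (1 : ℝ) else 0) + if ends e = (y, x) then 1 else 0) := by
  rw [adjMatrix, edgeMult, Fintype.card_subtype, Finset.card_filter]
  push_cast
  rw [Finset.mul_sum]
  refine Finset.sum_congr rfl fun e _ => ?_
  simp only [isLink_iff_ends G hends]
  by_cases hxy : x = y
  · subst hxy
    by_cases h : ends e = (x, x) <;> simp [h]
    norm_num
  · by_cases h1 : ends e = (x, y)
    · have h2 : ¬ ends e = (y, x) := by
        rw [h1]; intro h; exact hxy (Prod.ext_iff.mp h).1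
      simp [h1, hxy]
    · by_cases h2 : ends e = (y, x) <;> simp [h1, h2, hxy]

theorem sum_ends_eq_sum_adjMatrix [Fintype V(G)]
    (hends : ∀ e : E(G), G.IsLink e (ends e).1 (ends e).2) (f : V(G) → V(G) → ℝ) :
    ∑ e, (f (ends e).1 (ends e).2 + f (ends e).2 (ends e).1) =
      ∑ x, ∑ y, adjMatrix G x y * f x y := by
  classical
  have h1 : ∀ e, ∑ x, ∑ y, (if ends e = (x, y) then (1 : ℝ) else 0) * f x y =
      f (ends e).1 (ends e).2 := by
    intro e
    rw [Finset.sum_eq_single (ends e).1, Finset.sum_eq_single (ends e).2]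
    · simp
    · intro y _ hy
      rw [if_neg fun h => hy (by rw [h]), zero_mul]
    · simp
    · intro x _ hx
      refine Finset.sum_eq_zero fun y _ => ?_
      rw [if_neg fun h => hx (by rw [h]), zero_mul]
    · simp
  have h2 : ∀ e, ∑ x, ∑ y, (if ends e = (y, x) then (1 : ℝ) else 0) * f x y =
      f (ends e).2 (ends e).1 := by
    intro e
    rw [Finset.sum_eq_single (ends e).2, Finset.sum_eq_single (ends e).1]
    · simp
    · intro y _ hy
      rw [if_neg fun h => hy (by rw [h]), zero_mul]
    · simp
    · intro x _ hx
      refine Finset.sum_eq_zero fun y _ => ?_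
      rw [if_neg fun h => hx (by rw [h]), zero_mul]
    · simp
  simp only [adjMatrix_eq_sum_ends G hends, Finset.sum_mul, add_mul, Finset.sum_add_distrib]
  congr 1
  · rw [Finset.sum_congr rfl fun e _ => (h1 e).symm, Finset.sum_comm]
    exact Finset.sum_congr rfl fun x _ => Finset.sum_comm
  · rw [Finset.sum_congr rfl fun e _ => (h2 e).symm, Finset.sum_comm]
    exact Finset.sum_congr rfl fun x _ => Finset.sum_comm

end Endpoints

section OutcomeAdj

variable {S : Type*} {T : Set S} (ρ : ℕ)

open Classical in
/-- The weight of the sampled edge if the first walk ends at `s` and the second at `t`. -/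
noncomputable def orientedWeight (s t : T) : Option (ℕ × T) × Option (ℕ × T) → ℝ
  | (some (i, a), some (j, b)) =>
    if a = s ∧ b = t then 1 / ((ρ : ℝ) * ((i + 1 + j : ℕ) : ℝ)) else 0
  | _ => 0

theorem orientedWeight_nonneg (s t : T) (o : Option (ℕ × T) × Option (ℕ × T)) :
    0 ≤ orientedWeight ρ s t o := by
  unfold orientedWeight
  split
  · split_ifs
    · positivity
    · exact le_rfl
  · exact le_rfl

theorem one_div_mul_le_one (ρ l : ℕ) : 1 / ((ρ : ℝ) * (l : ℝ)) ≤ 1 := by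
  rcases Nat.eq_zero_or_pos (ρ * l) with h | h
  · rw [← Nat.cast_mul, h]; simp
  · rw [← Nat.cast_mul, div_le_one (by exact_mod_cast h)]
    exact_mod_cast h

theorem orientedWeight_le_one (s t : T) (o : Option (ℕ × T) × Option (ℕ × T)) :
    orientedWeight ρ s t o ≤ 1 := by
  unfold orientedWeight
  split
  · split_ifs
    · exact one_div_mul_le_one _ _
    · exact zero_le_one
  · exact zero_le_one

theorem outcomeAdj_apply (o o' : Option (ℕ × T)) (s t : T) :
    outcomeAdj T ρ o o' s t = orientedWeight ρ s t (o, o') + orientedWeight ρ t s (o, o') := by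
  rcases o with _ | ⟨i, a⟩ <;> rcases o' with _ | ⟨j, b⟩
  · simp [outcomeAdj, orientedWeight]
  · simp [outcomeAdj, orientedWeight]
  · simp [outcomeAdj, orientedWeight]
  · simp only [outcomeAdj, orientedWeight, Matrix.smul_apply, Matrix.add_apply, Matrix.single_apply,
      smul_eq_mul, mul_add, mul_ite, mul_one, mul_zero]
    congr 2
    exact propext and_comm

theorem outcomeAdj_nonneg (o o' : Option (ℕ × T)) (s t : T) : 0 ≤ outcomeAdj T ρ o o' s t := by
  rw [outcomeAdj_apply]
  exact add_nonneg (orientedWeight_nonneg _ _ _ _) (orientedWeight_nonneg _ _ _ _)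

theorem outcomeAdj_transpose (o o' : Option (ℕ × T)) :
    (outcomeAdj T ρ o o').transpose = outcomeAdj T ρ o o' := by
  ext s t
  rw [Matrix.transpose_apply, outcomeAdj_apply, outcomeAdj_apply, add_comm]

variable [Countable S]

theorem boundedMeasurable_orientedWeight (s t : T) : BoundedMeasurable (orientedWeight ρ s t) :=
  ⟨.of_discrete, 1, fun o => by
    rw [abs_of_nonneg (orientedWeight_nonneg _ _ _ _)]
    exact orientedWeight_le_one _ _ _ _⟩

theorem boundedMeasurableMatrix_outcomeAdj :
    BoundedMeasurableMatrix
      (fun o : Option (ℕ × T) × Option (ℕ × T) => outcomeAdj T ρ o.1 o.2) := by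
  intro s t
  simp only [outcomeAdj_apply]
  exact (boundedMeasurable_orientedWeight ρ s t).add (boundedMeasurable_orientedWeight ρ t s)

end OutcomeAdj

section Expectation

open Matrix

variable {α β : Type*} (G : Graph α β) [Fintype V(G)] [Fintype E(G)] (T : Set V(G)) (ρ : ℕ)

open Classical in
/-- The joint weight of hitting `T` at `s` after `i` steps from `u` and at `t` after `j` steps from
`v`, times the weight of the edge sampled in that case. -/
noncomputable def hitTerm (u v : V(G)) (s t : T) (p : ℕ × ℕ) : ℝ :=
  1 / ((ρ : ℝ) * ((p.1 + 1 + p.2 : ℕ) : ℝ)) *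
    ((killedMatrix G T ^ p.1) u s * (killedMatrix G T ^ p.2) v t)

theorem hasSum_hitTerm (u v : V(G)) (s t : T) :
    HasSum (hitTerm G T ρ u v s t)
      (∫ o, orientedWeight ρ s t o ∂((outcomeLaw G T u).prod (outcomeLaw G T v))) := by
  classical
  have hsum : Summable (hitTerm G T ρ u v s t) := by
    refine Summable.of_nonneg_of_le (fun p => ?_) (fun p => ?_)
      ((summable_killedMatrix_pow G T u s).mul_of_nonneg (summable_killedMatrix_pow G T v t)
        (fun i => killedMatrix_pow_nonneg G T i u s) fun j => killedMatrix_pow_nonneg G T j v t)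
    · exact mul_nonneg (by positivity)
        (mul_nonneg (killedMatrix_pow_nonneg G T _ _ _) (killedMatrix_pow_nonneg G T _ _ _))
    · exact mul_le_of_le_one_left
        (mul_nonneg (killedMatrix_pow_nonneg G T _ _ _) (killedMatrix_pow_nonneg G T _ _ _))
        (one_div_mul_le_one _ _)
  convert hsum.hasSum using 1
  rw [integral_countable ((boundedMeasurable_orientedWeight ρ s t).integrable _)]
  set g : ℕ × ℕ → Option (ℕ × T) × Option (ℕ × T) := fun p => (some (p.1, s), some (p.2, t)) with hg
  have hinj : Function.Injective g := by
    rintro ⟨i, j⟩ ⟨i', j'⟩ h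
    simpa [hg] using h
  rw [← hinj.tsum_eq]
  · refine tsum_congr fun p => ?_
    rw [hg, hitTerm, ← Set.singleton_prod_singleton, measureReal_prod_prod, outcomeLaw_singleton,
      outcomeLaw_singleton]
    simp [orientedWeight, mul_comm]
  · rintro ⟨o, o'⟩ ho
    rw [Function.mem_support] at ho
    have hw := right_ne_zero_of_smul ho
    rcases o with _ | ⟨i, a⟩ <;> rcases o' with _ | ⟨j, b⟩
    · simp [orientedWeight] at hw
    · simp [orientedWeight] at hw
    · simp [orientedWeight] at hw
    · have hab : a = s ∧ b = t := by
        by_contra hab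
        simp [orientedWeight, hab] at hw
      obtain ⟨rfl, rfl⟩ := hab
      exact ⟨(i, j), rfl⟩

theorem integral_orientedWeight_swap (u v : V(G)) (s t : T) :
    ∫ o, orientedWeight ρ t s o ∂((outcomeLaw G T u).prod (outcomeLaw G T v)) =
      ∫ o, orientedWeight ρ s t o ∂((outcomeLaw G T v).prod (outcomeLaw G T u)) := by
  refine (hasSum_hitTerm G T ρ u v t s).unique ?_
  have e : hitTerm G T ρ u v t s ∘ Equiv.prodComm ℕ ℕ = hitTerm G T ρ v u s t := by
    funext ⟨i, j⟩
    change hitTerm G T ρ u v t s (j, i) = _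
    simp only [hitTerm]
    rw [show j + 1 + i = i + 1 + j by ring]
    ring
  rw [← (Equiv.prodComm ℕ ℕ).hasSum_iff, e]
  exact hasSum_hitTerm G T ρ v u s t

/-- Summed over all oriented edges, the expected weights give the excursion matrix: an excursion
with `ℓ` edges arises from each of its `ℓ` edges, each time with weight `1 / (ρ ℓ)`. -/
theorem sum_adjMatrix_mul_integral_orientedWeight (s t : T) :
    ∑ x, ∑ y, adjMatrix G x y *
        ∫ o, orientedWeight ρ s t o ∂((outcomeLaw G T x).prod (outcomeLaw G T y)) =
      (ρ : ℝ)⁻¹ * excursionMatrix G T s t := by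
  classical
  have h1 : HasSum (fun p : ℕ × ℕ => ∑ x, ∑ y, adjMatrix G x y * hitTerm G T ρ x y s t p)
      (∑ x, ∑ y, adjMatrix G x y *
        ∫ o, orientedWeight ρ s t o ∂((outcomeLaw G T x).prod (outcomeLaw G T y))) :=
    hasSum_sum fun x _ => hasSum_sum fun y _ => (hasSum_hitTerm G T ρ x y s t).mul_left _
  have h2 : ∀ p : ℕ × ℕ, ∑ x, ∑ y, adjMatrix G x y * hitTerm G T ρ x y s t p =
      1 / ((ρ : ℝ) * ((p.1 + 1 + p.2 : ℕ) : ℝ)) *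
        (adjMatrix G * killedMatrix G T ^ (p.1 + p.2)) s t := by
    intro p
    rw [pow_add, ← Matrix.mul_assoc, ← killedMatrix_transpose_pow_mul_adjMatrix, Matrix.mul_assoc,
      Matrix.mul_apply, Finset.mul_sum]
    refine Finset.sum_congr rfl fun x _ => ?_
    rw [Matrix.mul_apply, Finset.mul_sum, Finset.mul_sum]
    refine Finset.sum_congr rfl fun y _ => ?_
    rw [transpose_apply, hitTerm]
    ring
  simp only [h2] at h1
  have h3 := (Equiv.hasSum_iff (Finset.HasAntidiagonal.sigmaAntidiagonalEquivProd (A := ℕ))).mpr h1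
  refine (h3.sigma (g := fun l => (ρ : ℝ)⁻¹ * (adjMatrix G * killedMatrix G T ^ l) s t)
    fun l => ?_).unique ((hasSum_excursionMatrix G T s t).mul_left (ρ : ℝ)⁻¹)
  -- the `l + 1` pairs `(i, j)` with `i + j = l` all contribute the same amount
  have h4 : ∀ {a : ℝ} {f : Finset.HasAntidiagonal.antidiagonal l → ℝ},
      ∑ c, f c = a → HasSum f a := by
    rintro _ f rfl
    exact hasSum_fintype f
  refine h4 ?_
  rw [Finset.univ_eq_attach]
  rw [Finset.sum_congr rfl (g := fun _ => 1 / ((ρ : ℝ) * ((l + 1 : ℕ) : ℝ)) *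
    (adjMatrix G * killedMatrix G T ^ l) s t)]
  · rw [Finset.sum_const, Finset.card_attach, Finset.Nat.card_antidiagonal, nsmul_eq_mul]
    have : ((l + 1 : ℕ) : ℝ) ≠ 0 := by positivity
    rw [one_div, mul_inv]
    field_simp
  · rintro ⟨⟨i, j⟩, hij⟩ _
    have hij' : i + j = l := Finset.HasAntidiagonal.mem_antidiagonal.mp hij
    simp only [Function.comp, Finset.HasAntidiagonal.sigmaAntidiagonalEquivProd_apply, hij']
    rw [show i + 1 + j = l + 1 by omega]

variable {ends : E(G) → V(G) × V(G)}

theorem sum_integral_outcomeAdj (hends : ∀ e : E(G), G.IsLink e (ends e).1 (ends e).2)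
    (hρ : ρ ≠ 0) (s t : T) :
    ∑ p : E(G) × Fin ρ, ∫ o, outcomeAdj T ρ o.1 o.2 s t
        ∂((outcomeLaw G T (ends p.1).1).prod (outcomeLaw G T (ends p.1).2)) =
      excursionMatrix G T s t := by
  have h1 : ∀ u v : V(G), ∫ o, outcomeAdj T ρ o.1 o.2 s t
        ∂((outcomeLaw G T u).prod (outcomeLaw G T v)) =
      ∫ o, orientedWeight ρ s t o ∂((outcomeLaw G T u).prod (outcomeLaw G T v)) +
        ∫ o, orientedWeight ρ s t o ∂((outcomeLaw G T v).prod (outcomeLaw G T u)) := by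
    intro u v
    simp only [outcomeAdj_apply]
    rw [integral_add ((boundedMeasurable_orientedWeight ρ s t).integrable _)
      ((boundedMeasurable_orientedWeight ρ t s).integrable _),
      integral_orientedWeight_swap G T ρ u v s t]
  simp only [h1]
  rw [Fintype.sum_prod_type]
  simp only [Finset.sum_const, Finset.card_univ, Fintype.card_fin, ← Finset.smul_sum]
  rw [sum_ends_eq_sum_adjMatrix G hends fun u v =>
    ∫ o, orientedWeight ρ s t o ∂((outcomeLaw G T u).prod (outcomeLaw G T v)),
    sum_adjMatrix_mul_integral_orientedWeight, nsmul_eq_mul, mul_inv_cancel_left₀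
      (Nat.cast_ne_zero.mpr hρ)]

end Expectation

section AlmostSure

open Matrix

variable {α β : Type*} (G : Graph α β) [Fintype V(G)] [Fintype E(G)] (T : Set V(G)) {ρ : ℕ}

open Classical in
theorem ae_outcomeLaw (u : V(G)) :
    ∀ᵐ o ∂outcomeLaw G T u, ∀ (i : ℕ) (s : T),
      o = some (i, s) → (killedMatrix G T ^ i) u s ≠ 0 := by
  rw [ae_all_iff]
  intro i
  rw [ae_all_iff]
  intro s
  by_cases h : (killedMatrix G T ^ i) u s = 0
  · have h0 : outcomeLaw G T u {some (i, s)} = 0 := by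
      rw [← outcomeLaw_singleton] at h
      exact (measureReal_eq_zero_iff (measure_ne_top _ _)).mp h
    filter_upwards [measure_eq_zero_iff_ae_notMem.mp h0] with o ho ho'
    exact absurd ho' ho
  · exact .of_forall fun _ _ => h

open Classical in
/-- Almost surely a sampled edge is dominated by the Schur complement. -/
theorem ae_posSemidef_smul_SC_sub_lap_outcomeAdj {u v : V(G)} (huv : edgeMult G u v ≠ 0) :
    ∀ᵐ o ∂(outcomeLaw G T u).prod (outcomeLaw G T v),
      ((ρ : ℝ)⁻¹ • SC G T - lap (outcomeAdj T ρ o.1 o.2)).PosSemidef := by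
  have hSC : (SC G T).PosSemidef := by
    rw [SC_eq_lap_excursionMatrix]
    exact posSemidef_lap (excursionMatrix_transpose G T) (excursionMatrix_nonneg G T)
  have h1 := (Measure.quasiMeasurePreserving_fst (μ := outcomeLaw G T u)
    (ν := outcomeLaw G T v)).ae (ae_outcomeLaw G T u)
  have h2 := (Measure.quasiMeasurePreserving_snd (μ := outcomeLaw G T u)
    (ν := outcomeLaw G T v)).ae (ae_outcomeLaw G T v)
  filter_upwards [h1, h2] with o ho1 ho2
  have hsymm := outcomeAdj_transpose (T := T) ρ o.1 o.2
  refine .of_dotProduct_mulVec_nonneg (IsHermitian.sub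
    (hSC.smul (inv_nonneg.mpr (Nat.cast_nonneg ρ))).isHermitian
    (posSemidef_lap hsymm (outcomeAdj_nonneg ρ _ _)).isHermitian) fun x => ?_
  have hq := two_mul_dotProduct_lap_mulVec hsymm x
  have hS := hSC.dotProduct_mulVec_nonneg x
  rw [star_trivial] at hS ⊢
  rw [sub_mulVec, dotProduct_sub, smul_mulVec, dotProduct_smul, smul_eq_mul, sub_nonneg]
  have h0 : 0 ≤ (ρ : ℝ)⁻¹ * (x ⬝ᵥ SC G T *ᵥ x) :=
    mul_nonneg (inv_nonneg.mpr (Nat.cast_nonneg ρ)) hS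
  obtain ⟨o, o'⟩ := o
  rcases o with _ | ⟨i, s⟩
  · simp only [outcomeAdj, Matrix.zero_apply, zero_mul, Finset.sum_const_zero] at hq ⊢
    linarith
  rcases o' with _ | ⟨j, t⟩
  · simp only [outcomeAdj, Matrix.zero_apply, zero_mul, Finset.sum_const_zero] at hq ⊢
    linarith
  have hd := sq_sub_le_of_killedMatrix_pow_ne_zero G huv (ho1 i s rfl) (ho2 j t rfl) x
  -- the sample is the Laplacian of a single edge of weight `w`
  set w : ℝ := 1 / ((ρ : ℝ) * ((i + 1 + j : ℕ) : ℝ)) with hw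
  have hwn : 0 ≤ w := by positivity
  have hl : (0 : ℝ) < ((i + 1 + j : ℕ) : ℝ) := by
    exact_mod_cast (by omega : 0 < i + 1 + j)
  have e1 : ∑ a, ∑ b, outcomeAdj T ρ (some (i, s)) (some (j, t)) a b * (x a - x b) ^ 2 =
      2 * (w * (x s - x t) ^ 2) := by
    simp only [outcomeAdj, ← hw, Matrix.smul_apply, Matrix.add_apply, Matrix.single_apply,
      smul_eq_mul, mul_assoc, ← Finset.mul_sum, add_mul, Finset.sum_add_distrib, ite_and, ite_mul,
      zero_mul, one_mul, Finset.sum_ite_eq, Finset.sum_ite_irrel, Finset.sum_const_zero,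
      Finset.mem_univ, if_true]
    ring
  have e2 : x ⬝ᵥ lap (outcomeAdj T ρ (some (i, s)) (some (j, t))) *ᵥ x = w * (x s - x t) ^ 2 := by
    linarith
  calc _ = w * (x s - x t) ^ 2 := e2
    _ ≤ w * (((i + 1 + j : ℕ) : ℝ) * (x ⬝ᵥ SC G T *ᵥ x)) := mul_le_mul_of_nonneg_left hd hwn
    _ = _ := by
      rw [hw, ← mul_assoc, one_div, mul_inv, mul_assoc (ρ : ℝ)⁻¹, inv_mul_cancel₀ hl.ne', mul_one]

end AlmostSure

/-! ### Concentration of the sampled Laplacian -/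

section Sampling

open Matrix

variable {α β : Type*} (G : Graph α β) [Fintype V(G)] [Fintype E(G)] (T : Set V(G)) (ρ : ℕ)
  {ends : E(G) → V(G) × V(G)}

theorem boundedMeasurableMatrix_lap {Ω n : Type*} [MeasurableSpace Ω] [Fintype n]
    {B : Ω → Matrix n n ℝ} (hB : BoundedMeasurableMatrix B) :
    BoundedMeasurableMatrix (fun ω => lap (B ω)) := by
  classical
  intro s t
  simp only [lap_apply]
  refine BoundedMeasurable.sub ?_ (hB s t)
  split_ifs
  · exact .sum _ fun y _ => hB s y
  · exact .const 0

theorem meanMatrix_lap {Ω n : Type*} [MeasurableSpace Ω] [Fintype n] {μ : Measure Ω}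
    [IsProbabilityMeasure μ] {B : Ω → Matrix n n ℝ} (hB : BoundedMeasurableMatrix B) :
    meanMatrix μ (fun ω => lap (B ω)) = lap (meanMatrix μ B) := by
  classical
  ext s t
  simp only [meanMatrix, of_apply, lap_apply]
  split_ifs
  · rw [integral_sub ((BoundedMeasurable.sum _ fun y _ => hB s y).integrable _)
      ((hB s t).integrable _), integral_finsetSum _ fun y _ => (hB s y).integrable _]
  · simp only [zero_sub]
    rw [integral_neg]

theorem ae_pi_forall {ι Ω : Type*} [Fintype ι] [MeasurableSpace Ω] {μ : ι → Measure Ω}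
    [∀ i, IsProbabilityMeasure (μ i)] {p : ι → Ω → Prop} (h : ∀ i, ∀ᵐ ω ∂μ i, p i ω) :
    ∀ᵐ ω ∂Measure.pi μ, ∀ i, p i (ω i) :=
  ae_all_iff.mpr fun i => (measurePreserving_eval μ i).quasiMeasurePreserving.ae (h i)

/-- The joint law of the outcomes of the two walks from the ends of an edge. -/
noncomputable def pairLaw (ends : E(G) → V(G) × V(G)) (p : E(G) × Fin ρ) :
    Measure (Option (ℕ × T) × Option (ℕ × T)) :=
  (outcomeLaw G T (ends p.1).1).prod (outcomeLaw G T (ends p.1).2)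

instance pairLaw_prob (ends : E(G) → V(G) × V(G)) (p : E(G) × Fin ρ) :
    IsProbabilityMeasure (pairLaw G T ρ ends p) := by
  unfold pairLaw; infer_instance

theorem measurePreserving_outcomes (ends : E(G) → V(G) × V(G)) :
    MeasurePreserving (fun (ω : E(G) × Fin ρ → (ℕ → V(G)) × (ℕ → V(G))) p =>
      (outcome T (ω p).1, outcome T (ω p).2)) (samplingLaw G ends ρ)
      (Measure.pi (pairLaw G T ρ ends)) := by
  have h : ∀ u, MeasurePreserving (outcome T) (walkLaw G u) (outcomeLaw G T u) := fun u =>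
    (measurable_outcome G T).measurePreserving _
  exact measurePreserving_pi _ _ (f := fun _ => Prod.map (outcome T) (outcome T))
    fun p => (h (ends p.1).1).prod (h (ends p.1).2)

open Classical in
/-- The Laplacian of a sampled edge, replaced by zero on the null event that it is not dominated by
the Schur complement. -/
noncomputable def dominatedSample (o : Option (ℕ × T) × Option (ℕ × T)) : Matrix T T ℝ :=
  if ((ρ : ℝ)⁻¹ • SC G T - lap (outcomeAdj T ρ o.1 o.2)).PosSemidef then
    lap (outcomeAdj T ρ o.1 o.2) else 0

open Classical in
theorem posSemidef_SC : (SC G T).PosSemidef := by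
  rw [SC_eq_lap_excursionMatrix]
  exact posSemidef_lap (excursionMatrix_transpose G T) (excursionMatrix_nonneg G T)

open Classical in
theorem posSemidef_dominatedSample (o : Option (ℕ × T) × Option (ℕ × T)) :
    (dominatedSample G T ρ o).PosSemidef := by
  unfold dominatedSample
  split_ifs
  · exact posSemidef_lap (outcomeAdj_transpose ρ _ _) (outcomeAdj_nonneg ρ _ _)
  · exact .zero

open Classical in
theorem posSemidef_smul_SC_sub_dominatedSample (o : Option (ℕ × T) × Option (ℕ × T)) :
    ((ρ : ℝ)⁻¹ • SC G T - dominatedSample G T ρ o).PosSemidef := by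
  unfold dominatedSample
  split_ifs with h
  · exact h
  · rw [sub_zero]
    exact (posSemidef_SC G T).smul (inv_nonneg.mpr (Nat.cast_nonneg ρ))

theorem boundedMeasurableMatrix_dominatedSample :
    BoundedMeasurableMatrix (dominatedSample G T ρ) := by
  classical
  intro s t
  obtain ⟨-, C, hC⟩ := boundedMeasurableMatrix_lap
    (boundedMeasurableMatrix_outcomeAdj (T := T) ρ) s t
  refine ⟨.of_discrete, C, fun o => ?_⟩
  change |dominatedSample G T ρ o s t| ≤ C
  unfold dominatedSample
  split_ifs
  · exact hC o
  · simpa using (abs_nonneg _).trans (hC o)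

open Classical in
theorem ae_dominatedSample_eq (hends : ∀ e : E(G), G.IsLink e (ends e).1 (ends e).2)
    (p : E(G) × Fin ρ) :
    ∀ᵐ o ∂pairLaw G T ρ ends p,
      dominatedSample G T ρ o = lap (outcomeAdj T ρ o.1 o.2) := by
  filter_upwards [ae_posSemidef_smul_SC_sub_lap_outcomeAdj (ρ := ρ) G T
    (edgeMult_ne_zero_of_isLink G (hends p.1))] with o ho
  rw [dominatedSample, if_pos ho]

open Classical in
/-- The sampled Laplacian is an unbiased estimator of the Schur complement. -/
theorem sum_meanMatrix_dominatedSample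
    (hends : ∀ e : E(G), G.IsLink e (ends e).1 (ends e).2) (hρ : ρ ≠ 0) :
    ∑ p, meanMatrix (pairLaw G T ρ ends p) (dominatedSample G T ρ) = SC G T := by
  have h1 : ∀ p, meanMatrix (pairLaw G T ρ ends p) (dominatedSample G T ρ) =
      lap (meanMatrix (pairLaw G T ρ ends p) fun o => outcomeAdj T ρ o.1 o.2) := by
    intro p
    rw [← meanMatrix_lap (boundedMeasurableMatrix_outcomeAdj ρ)]
    ext s t
    refine integral_congr_ae ?_
    filter_upwards [ae_dominatedSample_eq G T ρ hends p] with o ho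
    rw [ho]
  simp only [h1]
  rw [← lap_sum, SC_eq_lap_excursionMatrix]
  congr 1
  ext s t
  rw [Matrix.sum_apply]
  exact sum_integral_outcomeAdj G T ρ hends hρ s t

open Classical in
/-- Almost surely the sampled graph has only edges that are present in the Schur complement: the
expected total weight between `s` and `t` is `-SC G T s t`, and weights are nonnegative. -/
theorem ae_outcomeAdj_eq_zero (hends : ∀ e : E(G), G.IsLink e (ends e).1 (ends e).2) (hρ : ρ ≠ 0)
    {s t : T} (hst : s ≠ t) (h : SC G T s t = 0) (p : E(G) × Fin ρ) :
    ∀ᵐ o ∂pairLaw G T ρ ends p, outcomeAdj T ρ o.1 o.2 s t = 0 := by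
  have hB := sum_integral_outcomeAdj G T ρ hends hρ s t
  rw [SC_eq_lap_excursionMatrix, lap_apply, if_neg hst, zero_sub, neg_eq_zero] at h
  rw [h, Finset.sum_eq_zero_iff_of_nonneg fun p _ =>
    integral_nonneg fun o => outcomeAdj_nonneg ρ _ _ s t] at hB
  have h0 := hB p (Finset.mem_univ p)
  rwa [integral_eq_zero_iff_of_nonneg (fun o => outcomeAdj_nonneg ρ _ _ s t)
    ((boundedMeasurableMatrix_outcomeAdj ρ s t).integrable _)] at h0

open Classical in
theorem one_sub_le_samplingLaw_spectralApprox
    (hends : ∀ e : E(G), G.IsLink e (ends e).1 (ends e).2) (hρ : ρ ≠ 0) {ε : ℝ} (hε : 0 < ε)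
    {K : ℕ} (hK : K ≠ 0) (hKρ : 2 * K * (ρ : ℝ)⁻¹ ≤ 1) :
    1 - Fintype.card T * (10 * K * (ρ : ℝ)⁻¹ / ε ^ 2) ^ K ≤
      (samplingLaw G ends ρ).real
        {ω | SpectralApprox ε (sampledLaplacian G T ρ ω) (SC G T)} := by
  set A : Set (E(G) × Fin ρ → Option (ℕ × T) × Option (ℕ × T)) :=
    {o | SpectralApprox ε (lap (∑ p, outcomeAdj T ρ (o p).1 (o p).2)) (SC G T)} with hA
  have hpre : {ω | SpectralApprox ε (sampledLaplacian G T ρ ω) (SC G T)} =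
      (fun (ω : E(G) × Fin ρ → (ℕ → V(G)) × (ℕ → V(G))) p =>
        (outcome T (ω p).1, outcome T (ω p).2)) ⁻¹' A := by
    ext ω
    simp only [sampledLaplacian, sampleAdj_eq_outcomeAdj, hA, Set.mem_preimage, Set.mem_ofPred_eq]
  have hAm : MeasurableSet A := (Set.to_countable A).measurableSet
  rw [hpre, measureReal_def, (measurePreserving_outcomes G T ρ ends).measure_preimage
    hAm.nullMeasurableSet, ← measureReal_def]
  have hconc := one_sub_le_measureReal_forall_abs_dotProduct_sub_le
    (μ := pairLaw G T ρ ends) (X := fun _ => dominatedSample G T ρ) (S := SC G T)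
    (inv_pos.mpr (Nat.cast_pos.mpr (Nat.pos_of_ne_zero hρ))) hε
    (fun _ => boundedMeasurableMatrix_dominatedSample G T ρ)
    (fun _ => posSemidef_dominatedSample G T ρ)
    (fun _ => posSemidef_smul_SC_sub_dominatedSample G T ρ) (posSemidef_SC G T)
    (sum_meanMatrix_dominatedSample G T ρ hends hρ) hK hKρ
  refine hconc.trans (ENNReal.toReal_mono (measure_ne_top _ _) (measure_mono_ae ?_))
  have hae1 := ae_pi_forall fun p => ae_dominatedSample_eq G T ρ hends p
  have hae2 : ∀ᵐ o ∂Measure.pi (pairLaw G T ρ ends), ∀ s t : T, s ≠ t → SC G T s t = 0 →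
      ∀ p, outcomeAdj T ρ (o p).1 (o p).2 s t = 0 := by
    simp only [ae_all_iff]
    intro s t hst h p
    exact ae_all_iff.mp (ae_pi_forall fun p => ae_outcomeAdj_eq_zero G T ρ hends hρ hst h p) p
  filter_upwards [hae1, hae2] with o h1 h2 ho
  have hsum : lap (∑ p, outcomeAdj T ρ (o p).1 (o p).2) = ∑ p, dominatedSample G T ρ (o p) := by
    rw [lap_sum]
    exact Finset.sum_congr rfl fun p _ => (h1 p).symm
  refine ⟨fun s t hst hne h0 => hne ?_, fun x => ?_, fun x => ?_⟩
  · rw [lap_apply, if_neg hst, zero_sub, Matrix.sum_apply,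
      Finset.sum_eq_zero fun p _ => h2 s t hst h0 p, neg_zero]
  · rw [hsum]
    have := (abs_le.mp (ho x)).1
    linarith
  · rw [hsum]
    have := (abs_le.mp (ho x)).2
    linarith

/-- With `K = ⌈(c + 1) log n⌉ ≤ (c + 3) log n`, the lower bound on `ρ` makes the base of the `K`-th
power at most `exp (-1)`. -/
theorem exists_moment_order {c : ℝ} (hc : 0 < c) {n ρ : ℕ} (hn : 2 ≤ n) {ε : ℝ} (hε : 0 < ε)
    (hε1 : ε < 1)
    (hρ : 10 * (c + 3) * Real.exp 1 * (Real.log n * ε⁻¹ ^ 2) ≤ (ρ : ℝ)) :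
    ρ ≠ 0 ∧ ∃ K : ℕ, K ≠ 0 ∧ 2 * K * (ρ : ℝ)⁻¹ ≤ 1 ∧
      n * (10 * K * (ρ : ℝ)⁻¹ / ε ^ 2) ^ K ≤ (n : ℝ) ^ (-c) := by
  have hn2 : (2 : ℝ) ≤ n := by exact_mod_cast hn
  have hn0 : (0 : ℝ) < n := by linarith
  have hlog : 1 / 2 ≤ Real.log n :=
    le_trans (by have := Real.log_two_gt_d9; linarith) (Real.log_le_log two_pos hn2)
  have hρ0 : (0 : ℝ) < ρ := lt_of_lt_of_le (by positivity) hρ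
  refine ⟨fun h => by simp [h] at hρ0, ⌈(c + 1) * Real.log n⌉₊, ?_, ?_⟩
  · have : 0 < (c + 1) * Real.log n := by positivity
    exact (Nat.ceil_pos.mpr this).ne'
  set K := ⌈(c + 1) * Real.log n⌉₊ with hKdef
  have hK1 : (c + 1) * Real.log n ≤ K := Nat.le_ceil _
  have hK2 : (K : ℝ) ≤ (c + 3) * Real.log n := by
    have := Nat.ceil_lt_add_one (a := (c + 1) * Real.log n) (by positivity)
    rw [← hKdef] at this
    linarith
  have hbase : 10 * K * (ρ : ℝ)⁻¹ / ε ^ 2 ≤ Real.exp (-1) := by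
    rw [Real.exp_neg, div_le_iff₀ (by positivity), mul_inv_le_iff₀ hρ0, ← div_eq_inv_mul,
      div_mul_eq_mul_div, le_div_iff₀ (Real.exp_pos 1)]
    have h1 : 10 * (c + 3) * Real.exp 1 * Real.log n ≤ ε ^ 2 * ρ := by
      have := mul_le_mul_of_nonneg_left hρ (sq_nonneg ε)
      calc _ = ε ^ 2 * (10 * (c + 3) * Real.exp 1 * (Real.log n * ε⁻¹ ^ 2)) := by
            field_simp
        _ ≤ _ := this
    nlinarith [mul_le_mul_of_nonneg_right hK2 (Real.exp_pos 1).le]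
  have hbase0 : 0 ≤ 10 * K * (ρ : ℝ)⁻¹ / ε ^ 2 := by positivity
  constructor
  · have h1 : 10 * K * (ρ : ℝ)⁻¹ ≤ Real.exp (-1) * ε ^ 2 := (div_le_iff₀ (by positivity)).mp hbase
    have h2 : Real.exp (-1) ≤ 1 := Real.exp_le_one_iff.mpr (by norm_num)
    have h3 : Real.exp (-1) * ε ^ 2 ≤ 1 :=
      mul_le_one₀ h2 (sq_nonneg ε) (pow_le_one₀ hε.le hε1.le)
    have h4 : 0 ≤ (K : ℝ) * (ρ : ℝ)⁻¹ := by positivity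
    linarith
  · calc (n : ℝ) * (10 * K * (ρ : ℝ)⁻¹ / ε ^ 2) ^ K ≤ n * Real.exp (-1) ^ K := by gcongr
      _ = n * Real.exp (-K) := by rw [← Real.exp_nat_mul]; ring_nf
      _ ≤ n * Real.exp (-((c + 1) * Real.log n)) := by gcongr
      _ = (n : ℝ) ^ (-c) := by
        rw [Real.rpow_def_of_pos hn0]
        nth_rw 1 [← Real.exp_log hn0]
        rw [← Real.exp_add]
        ring_nf

end Sampling

end SchurWalks

open Classical in
theorem mainTheorem4 (c : ℝ) (hc : 0 < c) :
    ∃ C : ℝ, 0 < C ∧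
      ∀ (α β : Type*) (G : Graph α β) [Fintype V(G)] [Fintype E(G)]
        (ends : E(G) → V(G) × V(G)) (_ : ∀ e : E(G), G.IsLink e (ends e).1 (ends e).2)
        (T : Set V(G)) (ε : ℝ) (_ : 0 < ε) (_ : ε < 1)
        (ρ : ℕ) (_ : C * (Real.log (Fintype.card V(G)) * ε⁻¹ ^ 2) ≤ (ρ : ℝ)),
        1 - (Fintype.card V(G) : ℝ) ^ (-c) ≤
          (SchurWalks.samplingLaw G ends ρ).real
            {ω | SchurWalks.SpectralApprox ε (SchurWalks.sampledLaplacian G T ρ ω)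
              (SchurWalks.SC G T)} := by
  refine ⟨10 * (c + 3) * Real.exp 1, by positivity, ?_⟩
  intro α β G _ _ ends hends T ε hε hε1 ρ hρ
  rcases Nat.lt_or_ge (Fintype.card V(G)) 2 with hn | hn
  · rcases Nat.lt_or_ge (Fintype.card V(G)) 1 with hn0 | hn1
    · -- without vertices there is nothing to approximate
      have hV : IsEmpty V(G) := Fintype.card_eq_zero_iff.mp (by omega)
      have huniv : {ω | SchurWalks.SpectralApprox ε (SchurWalks.sampledLaplacian G T ρ ω)
          (SchurWalks.SC G T)} = Set.univ := by
        ext ω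
        simp only [Set.mem_ofPred_eq, Set.mem_univ, iff_true]
        refine ⟨fun s => isEmptyElim (s : V(G)), fun x => ?_, fun x => ?_⟩ <;>
          simp [dotProduct, Finset.univ_eq_empty]
      have : IsProbabilityMeasure (SchurWalks.samplingLaw G ends ρ) := by
        unfold SchurWalks.samplingLaw; infer_instance
      rw [huniv, probReal_univ, sub_le_self_iff]
      positivity
    · -- with a single vertex the failure probability `n ^ (-c)` is one
      have h1 : Fintype.card V(G) = 1 := by omega
      rw [h1, Nat.cast_one, Real.one_rpow, sub_self]
      exact measureReal_nonneg
  · obtain ⟨hρ0, K, hK, hKρ, hbound⟩ := SchurWalks.exists_moment_order hc hn hε hε1 hρ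
    have hcard : (Fintype.card T : ℝ) ≤ Fintype.card V(G) := by
      exact_mod_cast Fintype.card_subtype_le (fun x => x ∈ T)
    have hpow : 0 ≤ (10 * K * (ρ : ℝ)⁻¹ / ε ^ 2) ^ K := by positivity
    have := SchurWalks.one_sub_le_samplingLaw_spectralApprox G T ρ hends hρ0 hε hK hKρ
    linarith [mul_le_mul_of_nonneg_right hcard hpow]
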